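/- Fix a relational signature with countably infinitely many unary and countably infinitely many binary relation symbols, and variables $x_0,x_1,\dots$. An \emph{abstract logic} $\mathcal L$ consists of a collection of formulas, each having a finite set of free variables, and a truth relation $M\models_{\mathcal L}\varphi\,[\alpha]$ between formulas $\varphi$ and models $M$ with assignments $\alpha$, such that: truth depends only on the values of the free variables; truth is preserved under isomorphisms; $\mathcal L$ is closed under negation and conjunction; $\mathcal L$ is closed under renamings (for every arity-preserving map $\rho$ on relation symbols and every $\varphi\in\mathcal L$ there is $\psi\in\mathcal L$ with $M\models\psi\,[\alpha]$ iff $\rho(M)\models\varphi\,[\alpha]$ for all $M,\alpha$, where $\rho(M)$ interprets $R$ as $M$ interprets $\rho(R)$); and $\mathcal L$ is closed under relativisation (for every unary symbol $P$ and $\varphi\in\mathcal L$ there is $\psi\in\mathcal L$ such that, for all $M$ and all assignments $\alpha$ into $P^M$, $M\models\psi\,[\alpha]$ iff $M^P\models\varphi\,[\alpha]$, where $M^P$ is the submodel of $M$ induced by $P^M$). $\mathcal L$ \emph{extends} $\mathcal L'$ (equivalently, $\mathcal L'$ is \emph{no more expressive than} $\mathcal L$) if there is a map $f$ from $\mathcal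 L'$-formulas to $\mathcal L$-formulas with $M\models_{\mathcal L'}\varphi\,[\alpha]$ iff $M\models_{\mathcal L}f(\varphi)\,[\alpha]$ for all $\varphi,M,\alpha$. $\mathcal L$ has \emph{Compactness} if every set of $\mathcal L$-formulas all of whose finite subsets are satisfiable (by a model with an assignment) is satisfiable. The \emph{binary guarded fragment} $GF_{\mathsf{bin}}$ has the formulas $$\varphi ::= R\vec x \mid x=y \mid \neg\varphi \mid \varphi\lor\psi \mid \exists y\,(G(x,y)\land\psi(x,y)),$$ with $R$ a unary or binary relation symbol, and where in the last clause $x,y$ are distinct variables, $G$ is an atomic formula containing both $x$ and $y$ (in any order), and $\psi$ has no free variables besides possibly $x$ and $y$. It is an abstract logic under the usual first-order semantics. A set of elements of a model is \emph{guarded} if all its elements occur in a single tuple belonging to some atomic relation (a unary or binary relation of the model, or equality). A \emph{$GF_{\mathsf{bin}}$-bisimulation} between $M$ and $N$ is a non-empty set $F$ of finite partial isomorphisms between $M$ and $N$ such that for every $f:X\to Y$ in $F$: (i) for every guarded $Z\subseteq M$ with $X\cap Z\neq\emptyset$ there is $g\in F$ with domain $Z$ such that $g$ and $f$ agree on $X\cap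 Z$; (ii) for every guarded $W\subseteq N$ with $Y\cap W\neq\emptyset$ there is $g\in F$ with range $W$ such that $g^{-1}$ and $f^{-1}$ agree on $Y\cap W$. $\mathcal L$ is \emph{invariant for $GF_{\mathsf{bin}}$-bisimulation} if, for every $\varphi\in\mathcal L$ with free variables $x_{1},\dots,x_{n}$ and every $GF_{\mathsf{bin}}$-bisimulation $F$ between $M$ and $N$ that contains $\{(\alpha(x_i),\beta(x_i))\mid 1\le i\le n\}$, we have $M\models\varphi\,[\alpha]$ iff $N\models\varphi\,[\beta]$. \textbf{Theorem.} Let $\mathcal L$ be an abstract logic extending $GF_{\mathsf{bin}}$. Then $\mathcal L$ satisfies Compactness and invariance for $GF_{\mathsf{bin}}$-bisimulation if and only if $\mathcal L$ is no more expressive than $GF_{\mathsf{bin}}$. -/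

import Mathlib

namespace BinGuarded

/-- A model for the fixed signature with countably many unary relation symbols and countably
many binary relation symbols. (Formulas are evaluated at a model together with an assignment
of its elements to the variables, so an empty carrier plays no role.) -/
structure Model.{u} : Type (u + 1) where
  carrier : Type u
  un : ℕ → carrier → Prop
  bin : ℕ → carrier → carrier → Prop

/-- An isomorphism of models. -/
structure Model.Iso.{u} (M N : Model.{u}) extends Equiv M.carrier N.carrier where
  un_iff : ∀ i a, M.un i a ↔ N.un i (toFun a)
  bin_iff : ∀ i a b, M.bin i a b ↔ N.bin i (toFun a) (toFun b)

/-- For an arity-preserving map `(ρ₁, ρ₂)` on relation symbols, the model in which a symbol `R`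
is interpreted as the symbol `ρ R` is interpreted in `M`. -/
abbrev Model.rename.{u} (M : Model.{u}) (ρ₁ ρ₂ : ℕ → ℕ) : Model.{u} where
  carrier := M.carrier
  un i := M.un (ρ₁ i)
  bin i := M.bin (ρ₂ i)

/-- The submodel induced by the denotation of the unary relation symbol `p`. -/
abbrev Model.relativise.{u} (M : Model.{u}) (p : ℕ) : Model.{u} where
  carrier := {a : M.carrier // M.un p a}
  un i a := M.un i a.1
  bin i a b := M.bin i a.1 b.1

/-- An abstract logic, in the version for formulas with free variables. The variables are indexed
by natural numbers. Every formula has a finite set `fv` of free variables and is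
evaluated at a model with an assignment. -/
structure AbstractLogic.{u, v} : Type (max (u + 1) (v + 1)) where
  Fml : Type v
  fv : Fml → Finset ℕ
  Sat : Fml → (M : Model.{u}) → (ℕ → M.carrier) → Prop
  /-- truth depends only on the values of the free variables -/
  sat_congr : ∀ (φ : Fml) (M : Model.{u}) (α β : ℕ → M.carrier),
    (∀ x ∈ fv φ, α x = β x) → (Sat φ M α ↔ Sat φ M β)
  /-- preservation under isomorphisms -/
  sat_iso : ∀ (φ : Fml) (M N : Model.{u}) (e : Model.Iso M N) (α : ℕ → M.carrier),
    Sat φ M α ↔ Sat φ N (fun x => e.toFun (α x))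
  /-- closure under negation -/
  exists_neg : ∀ φ : Fml, ∃ ψ : Fml, ∀ (M : Model.{u}) (α : ℕ → M.carrier),
    Sat ψ M α ↔ ¬ Sat φ M α
  /-- closure under conjunction -/
  exists_and : ∀ φ ψ : Fml, ∃ χ : Fml, ∀ (M : Model.{u}) (α : ℕ → M.carrier),
    Sat χ M α ↔ (Sat φ M α ∧ Sat ψ M α)
  /-- closure under renamings -/
  exists_rename : ∀ (ρ₁ ρ₂ : ℕ → ℕ) (φ : Fml), ∃ ψ : Fml,
    ∀ (M : Model.{u}) (α : ℕ → M.carrier), Sat ψ M α ↔ Sat φ (M.rename ρ₁ ρ₂) α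
  /-- closure under relativisation by unary predicates -/
  exists_relativise : ∀ (p : ℕ) (φ : Fml), ∃ ψ : Fml,
    ∀ (M : Model.{u}) (α : ℕ → (M.relativise p).carrier),
      Sat ψ M (fun x => (α x).1) ↔ Sat φ (M.relativise p) α

namespace AbstractLogic

/-- `L` extends `L₀`: there is a truth-preserving map from the formulas of `L₀` to those
of `L`. Equivalently, `L₀` is no more expressive than `L`. -/
def Extends.{u, v, w} (L : AbstractLogic.{u, v}) (L₀ : AbstractLogic.{u, w}) : Prop :=
  ∃ f : L₀.Fml → L.Fml, ∀ (φ : L₀.Fml) (M : Model.{u}) (α : ℕ → M.carrier),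
    L₀.Sat φ M α ↔ L.Sat (f φ) M α

def Satisfiable.{u, v} (L : AbstractLogic.{u, v}) (S : Set L.Fml) : Prop :=
  ∃ (M : Model.{u}) (α : ℕ → M.carrier), ∀ φ ∈ S, L.Sat φ M α

def Compactness.{u, v} (L : AbstractLogic.{u, v}) : Prop :=
  ∀ S : Set L.Fml, (∀ T : Set L.Fml, T ⊆ S → T.Finite → L.Satisfiable T) → L.Satisfiable S

end AbstractLogic

/-! ### The binary guarded fragment -/

/-- Atomic formulas over unary and binary relation symbols, with equality. -/
inductive Atom : Type where
  | un (i x : ℕ)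
  | bin (i x y : ℕ)
  | eq (x y : ℕ)

namespace Atom

/-- The variables occurring in an atomic formula. -/
def vars : Atom → Finset ℕ
  | un _ x => {x}
  | bin _ x y => {x, y}
  | eq x y => {x, y}

def Sat.{u} : Atom → (M : Model.{u}) → (ℕ → M.carrier) → Prop
  | un i x, M, α => M.un i (α x)
  | bin i x y, M, α => M.bin i (α x) (α y)
  | eq x y, _, α => α x = α y

def rename (ρ₁ ρ₂ : ℕ → ℕ) : Atom → Atom
  | un i x => un (ρ₁ i) x
  | bin i x y => bin (ρ₂ i) x y
  | eq x y => eq x y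

theorem sat_congr.{u} (A : Atom) (M : Model.{u}) (α β : ℕ → M.carrier)
    (h : ∀ x ∈ A.vars, α x = β x) : A.Sat M α ↔ A.Sat M β := by
  cases A <;> simp_all [vars, Sat]

theorem sat_iso.{u} (A : Atom) (M N : Model.{u}) (e : Model.Iso M N) (α : ℕ → M.carrier) :
    A.Sat M α ↔ A.Sat N (fun x => e.toFun (α x)) := by
  cases A with
  | un i x => exact e.un_iff i _
  | bin i x y => exact e.bin_iff i _ _
  | eq x y => exact e.toEquiv.injective.eq_iff.symm

theorem vars_rename (ρ₁ ρ₂ : ℕ → ℕ) (A : Atom) : (A.rename ρ₁ ρ₂).vars = A.vars := by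
  cases A <;> rfl

theorem sat_rename.{u} (ρ₁ ρ₂ : ℕ → ℕ) (A : Atom) (M : Model.{u}) (α : ℕ → M.carrier) :
    (A.rename ρ₁ ρ₂).Sat M α ↔ A.Sat (M.rename ρ₁ ρ₂) α := by
  cases A <;> rfl

theorem sat_relativise.{u} (p : ℕ) (A : Atom) (M : Model.{u})
    (α : ℕ → (M.relativise p).carrier) :
    A.Sat M (fun x => (α x).1) ↔ A.Sat (M.relativise p) α := by
  cases A with
  | un i x => rfl
  | bin i x y => rfl
  | eq x y => exact Subtype.ext_iff.symm

end Atom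

/-- Raw formulas: `ex y G ψ` stands for `∃ y (G ∧ ψ)` with `G` an atomic formula. The syntactic
restrictions on guarded quantification are imposed by `RawFormula.IsGF`. -/
inductive RawFormula : Type where
  | atom (A : Atom)
  | neg (φ : RawFormula)
  | or (φ ψ : RawFormula)
  | ex (y : ℕ) (G : Atom) (ψ : RawFormula)

namespace RawFormula

/-- The free variables of a formula. -/
def fv : RawFormula → Finset ℕ
  | atom A => A.vars
  | neg φ => φ.fv
  | or φ ψ => φ.fv ∪ ψ.fv
  | ex y G ψ => (G.vars ∪ ψ.fv).erase y

/-- Membership in the binary guarded fragment: in `∃ y (G ∧ ψ)` the guard `G` contains exactly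
`y` and one further variable `x`, and `ψ` has no free variables besides `x` and `y`. -/
def IsGF : RawFormula → Prop
  | atom _ => True
  | neg φ => φ.IsGF
  | or φ ψ => φ.IsGF ∧ ψ.IsGF
  | ex y G ψ => (∃ x, x ≠ y ∧ G.vars = {x, y} ∧ ψ.fv ⊆ {x, y}) ∧ ψ.IsGF

def Sat.{u} : RawFormula → (M : Model.{u}) → (ℕ → M.carrier) → Prop
  | atom A, M, α => A.Sat M α
  | neg φ, M, α => ¬ φ.Sat M α
  | or φ ψ, M, α => φ.Sat M α ∨ ψ.Sat M α
  | ex y G ψ, M, α =>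
      ∃ d, G.Sat M (Function.update α y d) ∧ ψ.Sat M (Function.update α y d)

def and (φ ψ : RawFormula) : RawFormula := neg (or (neg φ) (neg ψ))

def rename (ρ₁ ρ₂ : ℕ → ℕ) : RawFormula → RawFormula
  | atom A => atom (A.rename ρ₁ ρ₂)
  | neg φ => neg (φ.rename ρ₁ ρ₂)
  | or φ ψ => or (φ.rename ρ₁ ρ₂) (ψ.rename ρ₁ ρ₂)
  | ex y G ψ => ex y (G.rename ρ₁ ρ₂) (ψ.rename ρ₁ ρ₂)

def relativise (p : ℕ) : RawFormula → RawFormula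
  | atom A => atom A
  | neg φ => neg (φ.relativise p)
  | or φ ψ => or (φ.relativise p) (ψ.relativise p)
  | ex y G ψ => ex y G (and (atom (Atom.un p y)) (ψ.relativise p))

theorem sat_and.{u} (φ ψ : RawFormula) (M : Model.{u}) (α : ℕ → M.carrier) :
    (and φ ψ).Sat M α ↔ (φ.Sat M α ∧ ψ.Sat M α) := by
  simp only [and, Sat]; tauto

theorem sat_congr.{u} (φ : RawFormula) (M : Model.{u}) : ∀ α β : ℕ → M.carrier,
    (∀ x ∈ φ.fv, α x = β x) → (φ.Sat M α ↔ φ.Sat M β) := by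
  induction φ with
  | atom A => exact fun α β h => A.sat_congr M α β h
  | neg φ ih => exact fun α β h => not_congr (ih α β h)
  | or φ ψ ih₁ ih₂ =>
    intro α β h
    exact or_congr (ih₁ α β fun x hx => h x (by simp [fv, hx]))
      (ih₂ α β fun x hx => h x (by simp [fv, hx]))
  | ex y G ψ ih =>
    intro α β h
    refine exists_congr fun d => and_congr ?_ ?_
    · refine G.sat_congr M _ _ fun x hx => ?_
      by_cases hxy : x = y
      · subst hxy; simp
      · simpa [hxy] using h x (by simp [fv, hx, hxy])
    · refine ih _ _ fun x hx => ?_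
      by_cases hxy : x = y
      · subst hxy; simp
      · simpa [hxy] using h x (by simp [fv, hx, hxy])

theorem sat_iso.{u} (φ : RawFormula) (M N : Model.{u}) (e : Model.Iso M N) :
    ∀ α : ℕ → M.carrier, φ.Sat M α ↔ φ.Sat N (fun x => e.toFun (α x)) := by
  induction φ with
  | atom A => exact fun α => A.sat_iso M N e α
  | neg φ ih => exact fun α => not_congr (ih α)
  | or φ ψ ih₁ ih₂ => exact fun α => or_congr (ih₁ α) (ih₂ α)
  | ex y G ψ ih =>
    intro α
    have key : ∀ d, (fun x => e.toFun (Function.update α y d x)) =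
        Function.update (fun x => e.toFun (α x)) y (e.toFun d) := by
      intro d; funext x
      by_cases hxy : x = y
      · subst hxy; simp
      · simp [hxy]
    simp only [Sat]
    constructor
    · rintro ⟨d, h₁, h₂⟩
      refine ⟨e.toFun d, ?_, ?_⟩
      · rw [← key]; exact (G.sat_iso M N e _).1 h₁
      · rw [← key]; exact (ih _).1 h₂
    · rintro ⟨d, h₁, h₂⟩
      obtain ⟨d, rfl⟩ := e.toEquiv.surjective d
      refine ⟨d, (G.sat_iso M N e _).2 ?_, (ih _).2 ?_⟩
      · rw [key]; exact h₁
      · rw [key]; exact h₂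

theorem fv_rename (ρ₁ ρ₂ : ℕ → ℕ) (φ : RawFormula) : (φ.rename ρ₁ ρ₂).fv = φ.fv := by
  induction φ with
  | atom A => exact A.vars_rename ρ₁ ρ₂
  | neg φ ih => exact ih
  | or φ ψ ih₁ ih₂ => simp [rename, fv, ih₁, ih₂]
  | ex y G ψ ih => simp [rename, fv, ih, Atom.vars_rename]

theorem isGF_rename (ρ₁ ρ₂ : ℕ → ℕ) (φ : RawFormula) (h : φ.IsGF) : (φ.rename ρ₁ ρ₂).IsGF := by
  induction φ with
  | atom A => trivial
  | neg φ ih => exact ih h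
  | or φ ψ ih₁ ih₂ => exact ⟨ih₁ h.1, ih₂ h.2⟩
  | ex y G ψ ih =>
    refine ⟨?_, ih h.2⟩
    rw [Atom.vars_rename, fv_rename]
    exact h.1

theorem sat_rename.{u} (ρ₁ ρ₂ : ℕ → ℕ) (φ : RawFormula) (M : Model.{u}) :
    ∀ α : ℕ → M.carrier, (φ.rename ρ₁ ρ₂).Sat M α ↔ φ.Sat (M.rename ρ₁ ρ₂) α := by
  induction φ with
  | atom A => exact fun α => A.sat_rename ρ₁ ρ₂ M α
  | neg φ ih => exact fun α => not_congr (ih α)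
  | or φ ψ ih₁ ih₂ => exact fun α => or_congr (ih₁ α) (ih₂ α)
  | ex y G ψ ih =>
    exact fun α => exists_congr fun d => and_congr (G.sat_rename ρ₁ ρ₂ M _) (ih _)

theorem isGF_relativise (p : ℕ) (φ : RawFormula) (h : φ.IsGF) :
    (φ.relativise p).IsGF ∧ (φ.relativise p).fv ⊆ φ.fv := by
  induction φ with
  | atom A => exact ⟨trivial, subset_rfl⟩
  | neg φ ih => exact ih h
  | or φ ψ ih₁ ih₂ =>
    exact ⟨⟨(ih₁ h.1).1, (ih₂ h.2).1⟩, Finset.union_subset_union (ih₁ h.1).2 (ih₂ h.2).2⟩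
  | ex y G ψ ih =>
    obtain ⟨⟨x, hxy, hG, hψ⟩, hψ'⟩ := h
    obtain ⟨h₁, h₂⟩ := ih hψ'
    refine ⟨⟨⟨x, hxy, hG, ?_⟩, ⟨trivial, h₁⟩⟩, ?_⟩
    · refine Finset.union_subset ?_ (h₂.trans hψ)
      simp [fv, Atom.vars]
    · intro z hz
      simp only [relativise, and, fv, Atom.vars, Finset.mem_erase, Finset.mem_union,
        Finset.mem_singleton] at hz ⊢
      refine ⟨hz.1, ?_⟩
      rcases hz.2 with hz' | hz' | hz'
      · exact Or.inl hz'
      · exact absurd hz' hz.1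
      · exact Or.inr (h₂ hz')

theorem sat_relativise.{u} (p : ℕ) (φ : RawFormula) (M : Model.{u}) :
    ∀ α : ℕ → (M.relativise p).carrier,
      (φ.relativise p).Sat M (fun x => (α x).1) ↔ φ.Sat (M.relativise p) α := by
  induction φ with
  | atom A => exact fun α => A.sat_relativise p M α
  | neg φ ih => exact fun α => not_congr (ih α)
  | or φ ψ ih₁ ih₂ => exact fun α => or_congr (ih₁ α) (ih₂ α)
  | ex y G ψ ih =>
    intro α
    have key : ∀ d : (M.relativise p).carrier, Function.update (fun x => (α x).1) y d.1 =
        fun x => (Function.update α y d x).1 := by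
      intro d; funext x
      by_cases hxy : x = y
      · subst hxy; simp
      · simp [hxy]
    simp only [relativise, Sat, sat_and]
    constructor
    · rintro ⟨d, h₁, h₂, h₃⟩
      have hd : M.un p d := by simpa [Atom.Sat] using h₂
      refine ⟨⟨d, hd⟩, (G.sat_relativise p M _).1 ?_, (ih _).1 ?_⟩
      · rw [← key ⟨d, hd⟩]; exact h₁
      · rw [← key ⟨d, hd⟩]; exact h₃
    · rintro ⟨d, h₁, h₂⟩
      refine ⟨d.1, ?_, ?_, ?_⟩
      · rw [key]; exact (G.sat_relativise p M _).2 h₁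
      · simpa [Atom.Sat] using d.2
      · rw [key]; exact (ih _).2 h₂

end RawFormula

/-- The binary guarded fragment as an abstract logic. -/
def GFbin.{u} : AbstractLogic.{u, 0} where
  Fml := {φ : RawFormula // φ.IsGF}
  fv φ := φ.1.fv
  Sat φ M α := φ.1.Sat M α
  sat_congr φ M := φ.1.sat_congr M
  sat_iso φ M N e := φ.1.sat_iso M N e
  exists_neg φ := ⟨⟨φ.1.neg, φ.2⟩, fun _ _ => Iff.rfl⟩
  exists_and φ ψ := ⟨⟨φ.1.and ψ.1, φ.2, ψ.2⟩, fun M α => φ.1.sat_and ψ.1 M α⟩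
  exists_rename ρ₁ ρ₂ φ :=
    ⟨⟨φ.1.rename ρ₁ ρ₂, φ.1.isGF_rename ρ₁ ρ₂ φ.2⟩, fun M => φ.1.sat_rename ρ₁ ρ₂ M⟩
  exists_relativise p φ :=
    ⟨⟨φ.1.relativise p, (φ.1.isGF_relativise p φ.2).1⟩, fun M => φ.1.sat_relativise p M⟩

/-! ### Bisimulations for the binary guarded fragment -/

/-- A set of elements is guarded if some tuple belonging to some atomic relation (a unary
relation, a binary relation, or equality) contains all of its elements. -/
def Model.IsGuarded.{u} (M : Model.{u}) (Z : Set M.carrier) : Prop :=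
  (∃ i a, M.un i a ∧ Z ⊆ {a}) ∨ (∃ i a b, M.bin i a b ∧ Z ⊆ {a, b}) ∨
    (∃ a b, a = b ∧ Z ⊆ {a, b})

/-- The set of pairs `f` is the graph of a finite partial isomorphism from `M` to `N`. -/
structure IsFinitePartialIso.{u} (M N : Model.{u}) (f : Set (M.carrier × N.carrier)) : Prop where
  finite : f.Finite
  eq_iff : ∀ p ∈ f, ∀ q ∈ f, (p.1 = q.1 ↔ p.2 = q.2)
  un_iff : ∀ i, ∀ p ∈ f, (M.un i p.1 ↔ N.un i p.2)
  bin_iff : ∀ i, ∀ p ∈ f, ∀ q ∈ f, (M.bin i p.1 q.1 ↔ N.bin i p.2 q.2)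

/-- Bisimulations for the binary guarded fragment: non-empty sets `F` of (graphs of) finite
partial isomorphisms with the back-and-forth conditions for those guarded sets
that meet the domain, respectively the range, of the given map. -/
structure IsGFbinBisimulation.{u} (M N : Model.{u})
    (F : Set (Set (M.carrier × N.carrier))) : Prop where
  nonempty : F.Nonempty
  partialIso : ∀ f ∈ F, IsFinitePartialIso M N f
  forth : ∀ f ∈ F, ∀ Z : Set M.carrier, M.IsGuarded Z → (Prod.fst '' f ∩ Z).Nonempty →
    ∃ g ∈ F, Prod.fst '' g = Z ∧
      ∀ a ∈ Prod.fst '' f ∩ Z, ∀ b, (a, b) ∈ g ↔ (a, b) ∈ f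
  back : ∀ f ∈ F, ∀ W : Set N.carrier, N.IsGuarded W → (Prod.snd '' f ∩ W).Nonempty →
    ∃ g ∈ F, Prod.snd '' g = W ∧
      ∀ b ∈ Prod.snd '' f ∩ W, ∀ a, (a, b) ∈ g ↔ (a, b) ∈ f

/-- Every formula `φ` has the same truth value at `(M, α)` and `(N, β)` whenever there is a
bisimulation between `M` and `N` that is rooted at the values of the free variables of `φ`,
i.e. that contains the map sending `α x` to `β x` for each free variable `x` of `φ`. -/
def AbstractLogic.InvariantForGFbinBisimulation.{u, v} (L : AbstractLogic.{u, v}) : Prop :=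
  ∀ (φ : L.Fml) (M N : Model.{u}) (α : ℕ → M.carrier) (β : ℕ → N.carrier)
    (F : Set (Set (M.carrier × N.carrier))), IsGFbinBisimulation M N F →
    (fun x => (α x, β x)) '' (L.fv φ : Set ℕ) ∈ F → (L.Sat φ M α ↔ L.Sat φ N β)

end BinGuarded

universe u v

namespace BinGuarded

/-! ### Compatible pairs of points and invariance -/

/-! The substance is that Compactness and invariance force each formula φ of `L` into the binary
guarded fragment. Over finitely many symbols there are finitely many types of a given rank, each
definable by a guarded formula. Hence a φ that is not definable separates, for every k, two pointed
models that agree up to rank k on the first k symbols (`isDefinable_of_sameType`).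

To pass to a limit in k, both models are put into a single structure. Guarded formulas see only what
is reachable along edges, so instead of coding a relation between two disjoint copies, the models
are unravelled into one `jointTree` in which matched points are identified. Unary symbols 0 and 1
mark the two sides, and the remaining symbols are divided between the sides by parity. Each side is
bisimilar to its original (`isCompatible_jointTree`), and the sides coincide along paths of length
at most k over symbols below k (`jointTree_coincide`).

Coincidence along one fixed path is a guarded property (`IsDefinable.coincide`), while renaming and
relativisation let `L` evaluate φ on each side. Compactness yields one model where the sides
coincide along all paths from the assigned points, yet φ holds on one side and fails on the other.
The identity generates a bisimulation between these sides (`isCompatible_side`), a contradiction.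

The converse transfers Łoś's theorem and bisimulation invariance from guarded formulas to `L`; the
delicate point is that a translation may have extra free variables. -/

theorem Model.IsGuarded.exists_eq_pair {M : Model.{u}} {Z : Set M.carrier} (hZ : M.IsGuarded Z)
    {s : M.carrier} (hs : s ∈ Z) :
    ∃ e, Z = {s, e} ∧ (e = s ∨ ∃ i, M.bin i s e ∨ M.bin i e s) := by
  have single : ∀ a, Z ⊆ {a} → ∃ e, Z = {s, e} ∧ (e = s ∨ ∃ i, M.bin i s e ∨ M.bin i e s) := by
    intro a h
    obtain rfl : s = a := h hs
    refine ⟨s, ?_, Or.inl rfl⟩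
    rw [Set.pair_eq_singleton]
    exact h.antisymm (by simpa using hs)
  rcases hZ with ⟨i, a, -, h⟩ | ⟨i, a, b, hab, h⟩ | ⟨a, b, rfl, h⟩
  · exact single a h
  · by_cases ha : a ∈ Z <;> by_cases hb : b ∈ Z
    · have hZ' : Z = {a, b} := h.antisymm (by rintro x (rfl | rfl) <;> assumption)
      rcases h hs with rfl | rfl
      · exact ⟨b, hZ', Or.inr ⟨i, Or.inl hab⟩⟩
      · exact ⟨a, hZ'.trans (Set.pair_comm _ _), Or.inr ⟨i, Or.inr hab⟩⟩
    · refine single a fun x hx => ?_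
      rcases h hx with rfl | rfl
      · rfl
      · exact absurd hx hb
    · refine single b fun x hx => ?_
      rcases h hx with rfl | rfl
      · exact absurd hx ha
      · rfl
    · rcases h hs with rfl | rfl <;> contradiction
  · exact single a (by simpa using h)

/-- A relation between pairs of points that generates a bisimulation: its members are the finite
sets of pairs any two of which are related. -/
structure IsCompatible (M N : Model.{u})
    (R : M.carrier × N.carrier → M.carrier × N.carrier → Prop) : Prop where
  symm : ∀ p q, R p q → R q p
  eq_iff : ∀ p q, R p q → (p.1 = q.1 ↔ p.2 = q.2)
  un_iff : ∀ p, R p p → ∀ i, M.un i p.1 ↔ N.un i p.2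
  bin_iff : ∀ p q, R p q → ∀ i, M.bin i p.1 q.1 ↔ N.bin i p.2 q.2
  forth : ∀ p e, R p p → ∀ i, (M.bin i p.1 e ∨ M.bin i e p.1) →
    ∃ e', R p (e, e') ∧ R (e, e') (e, e')
  back : ∀ p e', R p p → ∀ i, (N.bin i p.2 e' ∨ N.bin i e' p.2) →
    ∃ e, R p (e, e') ∧ R (e, e') (e, e')

/-- A guarded set has at most two elements, so one that meets the domain is a point of the domain
together with at most one neighbour. Pairwise conditions therefore suffice. -/
theorem IsCompatible.isGFbinBisimulation {M N : Model.{u}}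
    {R : M.carrier × N.carrier → M.carrier × N.carrier → Prop} (hR : IsCompatible M N R) :
    IsGFbinBisimulation M N {f | f.Finite ∧ ∀ p ∈ f, ∀ q ∈ f, R p q} where
  nonempty := ⟨∅, by simp⟩
  partialIso f hf :=
    { finite := hf.1
      eq_iff := fun p hp q hq => hR.eq_iff p q (hf.2 p hp q hq)
      un_iff := fun i p hp => hR.un_iff p (hf.2 p hp p hp) i
      bin_iff := fun i p hp q hq => hR.bin_iff p q (hf.2 p hp q hq) i }
  forth := by
    rintro f ⟨-, hf⟩ Z hZ ⟨s, ⟨p, hp, rfl⟩, hs⟩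
    obtain ⟨e, rfl, he⟩ := hZ.exists_eq_pair hs
    -- The last conjunct gives agreement with `f` when both points of the guarded set already lie in
    -- its domain.
    have key : ∃ q, q.1 = e ∧ R p q ∧ R q q ∧ (e ∈ Prod.fst '' f → q ∈ f) := by
      by_cases hef : e ∈ Prod.fst '' f
      · obtain ⟨q, hq, rfl⟩ := hef
        exact ⟨q, rfl, hf p hp q hq, hf q hq q hq, fun _ => hq⟩
      · rcases he with rfl | ⟨i, hi⟩
        · exact absurd ⟨p, hp, rfl⟩ hef
        · obtain ⟨e', h₁, h₂⟩ := hR.forth p e (hf p hp p hp) i hi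
          exact ⟨(e, e'), rfl, h₁, h₂, fun h => absurd h hef⟩
    obtain ⟨q, rfl, hpq, hqq, hqf⟩ := key
    refine ⟨{p, q}, ⟨by simp, ?_⟩, by simp [Set.image_pair], ?_⟩
    · rintro _ (rfl | rfl) _ (rfl | rfl)
      exacts [hf _ hp _ hp, hpq, hR.symm _ _ hpq, hqq]
    · rintro a ⟨ha, ha'⟩ b
      constructor
      · rintro (h | h)
        · exact h ▸ hp
        · rw [Set.mem_singleton_iff] at h
          subst h
          exact hqf ha
      · intro hab
        rcases ha' with rfl | rfl
        · exact Or.inl (Prod.ext rfl (((hR.eq_iff _ _ (hf _ hab _ hp)).1 rfl)))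
        · exact Or.inr (Prod.ext rfl (((hR.eq_iff _ _ (hf _ hab _ (hqf ha))).1 rfl)))
  back := by
    rintro f ⟨-, hf⟩ Z hZ ⟨s, ⟨p, hp, rfl⟩, hs⟩
    obtain ⟨e, rfl, he⟩ := hZ.exists_eq_pair hs
    have key : ∃ q, q.2 = e ∧ R p q ∧ R q q ∧ (e ∈ Prod.snd '' f → q ∈ f) := by
      by_cases hef : e ∈ Prod.snd '' f
      · obtain ⟨q, hq, rfl⟩ := hef
        exact ⟨q, rfl, hf p hp q hq, hf q hq q hq, fun _ => hq⟩
      · rcases he with rfl | ⟨i, hi⟩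
        · exact absurd ⟨p, hp, rfl⟩ hef
        · obtain ⟨e', h₁, h₂⟩ := hR.back p e (hf p hp p hp) i hi
          exact ⟨(e', e), rfl, h₁, h₂, fun h => absurd h hef⟩
    obtain ⟨q, rfl, hpq, hqq, hqf⟩ := key
    refine ⟨{p, q}, ⟨by simp, ?_⟩, by simp [Set.image_pair], ?_⟩
    · rintro _ (rfl | rfl) _ (rfl | rfl)
      exacts [hf _ hp _ hp, hpq, hR.symm _ _ hpq, hqq]
    · rintro b ⟨hb, hb'⟩ a
      constructor
      · rintro (h | h)
        · exact h ▸ hp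
        · rw [Set.mem_singleton_iff] at h
          subst h
          exact hqf hb
      · intro hab
        rcases hb' with rfl | rfl
        · exact Or.inl (Prod.ext (((hR.eq_iff _ _ (hf _ hab _ hp)).2 rfl)) rfl)
        · exact Or.inr (Prod.ext (((hR.eq_iff _ _ (hf _ hab _ (hqf hb))).2 rfl)) rfl)

theorem AbstractLogic.InvariantForGFbinBisimulation.sat_iff_of_isCompatible
    {L : AbstractLogic.{u, v}} (hL : L.InvariantForGFbinBisimulation) (φ : L.Fml)
    {M N : Model.{u}} {R : M.carrier × N.carrier → M.carrier × N.carrier → Prop}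
    (hR : IsCompatible M N R) (α : ℕ → M.carrier) (β : ℕ → N.carrier)
    (h : ∀ x y, R (α x, β x) (α y, β y)) : L.Sat φ M α ↔ L.Sat φ N β := by
  refine hL φ M N α β _ hR.isGFbinBisimulation ⟨(Finset.finite_toSet _).image _, ?_⟩
  rintro _ ⟨x, -, rfl⟩ _ ⟨y, -, rfl⟩
  exact h x y

/-! ### The binary guarded fragment is invariant -/

theorem Atom.isGuarded_of_sat {M : Model.{u}} {G : Atom} {x y : ℕ} (hG : G.vars = {x, y})
    {α : ℕ → M.carrier} (h : G.Sat M α) : M.IsGuarded {α x, α y} := by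
  have key : ∀ s t : ℕ, ({x, y} : Finset ℕ) = {s, t} →
      ({α x, α y} : Set M.carrier) ⊆ {α s, α t} := by
    intro s t hst
    have hx : x ∈ ({s, t} : Finset ℕ) := hst ▸ by simp
    have hy : y ∈ ({s, t} : Finset ℕ) := hst ▸ by simp
    simp only [Finset.mem_insert, Finset.mem_singleton] at hx hy
    rintro z (rfl | rfl)
    · rcases hx with rfl | rfl <;> simp
    · rcases hy with rfl | rfl <;> simp
  cases G with
  | un i s =>
    refine Or.inl ⟨i, α s, h, ?_⟩
    simpa using key s s (by rw [← hG]; simp [Atom.vars])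
  | bin i s t => exact Or.inr (Or.inl ⟨i, α s, α t, h, key s t hG.symm⟩)
  | eq s t => exact Or.inr (Or.inr ⟨α s, α t, h, key s t hG.symm⟩)

theorem IsFinitePartialIso.atom_sat_iff {M N : Model.{u}} {f : Set (M.carrier × N.carrier)}
    (hf : IsFinitePartialIso M N f) (A : Atom) {α : ℕ → M.carrier} {β : ℕ → N.carrier}
    (h : ∀ x ∈ A.vars, (α x, β x) ∈ f) : A.Sat M α ↔ A.Sat N β := by
  cases A with
  | un i x => exact hf.un_iff i _ (h x (by simp [Atom.vars]))
  | bin i x y => exact hf.bin_iff i _ (h x (by simp [Atom.vars])) _ (h y (by simp [Atom.vars]))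
  | eq x y => exact hf.eq_iff _ (h x (by simp [Atom.vars])) _ (h y (by simp [Atom.vars]))

/-- In the quantifier case the guard makes {α x, d} a guarded set, and it meets the domain of `f`
because `x` stays free in the quantified formula. This is exactly the situation in which back and
forth are available. -/
theorem IsGFbinBisimulation.sat_iff {M N : Model.{u}} {F : Set (Set (M.carrier × N.carrier))}
    (hF : IsGFbinBisimulation M N F) {φ : RawFormula} (hφ : φ.IsGF) :
    ∀ f ∈ F, ∀ (α : ℕ → M.carrier) (β : ℕ → N.carrier), (∀ x ∈ φ.fv, (α x, β x) ∈ f) →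
      (φ.Sat M α ↔ φ.Sat N β) := by
  induction φ with
  | atom A => exact fun f hf α β h => (hF.partialIso f hf).atom_sat_iff A h
  | neg φ ih => exact fun f hf α β h => not_congr (ih hφ f hf α β h)
  | or φ ψ ih₁ ih₂ =>
    exact fun f hf α β h => or_congr
      (ih₁ hφ.1 f hf α β fun x hx => h x (by simp [RawFormula.fv, hx]))
      (ih₂ hφ.2 f hf α β fun x hx => h x (by simp [RawFormula.fv, hx]))
  | ex y G ψ ih =>
    intro f hf α β h
    obtain ⟨⟨x, hxy, hG, hψ⟩, hψ'⟩ := hφ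
    have hx : (α x, β x) ∈ f := h x (by simp [RawFormula.fv, hG, hxy])
    have transfer : ∀ g ∈ F, ∀ d d', (α x, β x) ∈ g → (d, d') ∈ g →
        ((G.Sat M (Function.update α y d) ∧ ψ.Sat M (Function.update α y d)) ↔
          (G.Sat N (Function.update β y d') ∧ ψ.Sat N (Function.update β y d'))) := by
      intro g hg d d' hxg hdg
      have hmem : ∀ z ∈ ({x, y} : Finset ℕ),
          (Function.update α y d z, Function.update β y d' z) ∈ g := by
        intro z hz
        simp only [Finset.mem_insert, Finset.mem_singleton] at hz
        rcases hz with rfl | rfl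
        · simpa [hxy] using hxg
        · simpa using hdg
      exact and_congr ((hF.partialIso g hg).atom_sat_iff G fun z hz => hmem z (hG ▸ hz))
        (ih hψ' g hg _ _ fun z hz => hmem z (hψ hz))
    constructor
    · rintro ⟨d, h₁, h₂⟩
      have hgd := Atom.isGuarded_of_sat hG h₁
      simp only [Function.update_of_ne hxy, Function.update_self] at hgd
      obtain ⟨g, hg, hdom, hag⟩ := hF.forth f hf _ hgd ⟨α x, ⟨_, hx, rfl⟩, by simp⟩
      have hd : d ∈ Prod.fst '' g := hdom ▸ by simp
      obtain ⟨⟨_, d'⟩, hdg, rfl⟩ := hd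
      exact ⟨d', (transfer g hg _ d' ((hag (α x) ⟨⟨_, hx, rfl⟩, by simp⟩ _).2 hx) hdg).1 ⟨h₁, h₂⟩⟩
    · rintro ⟨d', h₁, h₂⟩
      have hgd := Atom.isGuarded_of_sat hG h₁
      simp only [Function.update_of_ne hxy, Function.update_self] at hgd
      obtain ⟨g, hg, hran, hag⟩ := hF.back f hf _ hgd ⟨β x, ⟨_, hx, rfl⟩, by simp⟩
      have hd : d' ∈ Prod.snd '' g := hran ▸ by simp
      obtain ⟨⟨d, _⟩, hdg, rfl⟩ := hd
      exact ⟨d, (transfer g hg d _ ((hag (β x) ⟨⟨_, hx, rfl⟩, by simp⟩ _).2 hx) hdg).2 ⟨h₁, h₂⟩⟩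

/-- The disjoint union of two models. -/
abbrev Model.sum (M N : Model.{u}) : Model.{u} where
  carrier := M.carrier ⊕ N.carrier
  un i := Sum.elim (M.un i) (N.un i)
  bin i a b := Sum.elim (fun a => Sum.elim (M.bin i a) (fun _ => False) b)
    (fun a => Sum.elim (fun _ => False) (N.bin i a) b) a

theorem isCompatible_inl (M N : Model.{u}) :
    IsCompatible M (M.sum N) fun p q => p.2 = Sum.inl p.1 ∧ q.2 = Sum.inl q.1 where
  symm _ _ h := ⟨h.2, h.1⟩
  eq_iff p q h := by rw [h.1, h.2]; exact Sum.inl_injective.eq_iff.symm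
  un_iff p h i := by rw [h.1]; rfl
  bin_iff p q h i := by rw [h.1, h.2]; rfl
  forth p e h i _ := ⟨Sum.inl e, ⟨h.1, rfl⟩, rfl, rfl⟩
  back p e' h i he := by
    rw [h.1] at he
    rcases e' with e | e
    · exact ⟨e, ⟨h.1, rfl⟩, rfl, rfl⟩
    · rcases he with he | he <;> exact he.elim

theorem isCompatible_inr (M N : Model.{u}) :
    IsCompatible N (M.sum N) fun p q => p.2 = Sum.inr p.1 ∧ q.2 = Sum.inr q.1 where
  symm _ _ h := ⟨h.2, h.1⟩
  eq_iff p q h := by rw [h.1, h.2]; exact Sum.inr_injective.eq_iff.symm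
  un_iff p h i := by rw [h.1]; rfl
  bin_iff p q h i := by rw [h.1, h.2]; rfl
  forth p e h i _ := ⟨Sum.inr e, ⟨h.1, rfl⟩, rfl, rfl⟩
  back p e' h i he := by
    rw [h.1] at he
    rcases e' with e | e
    · rcases he with he | he <;> exact he.elim
    · exact ⟨e, ⟨h.1, rfl⟩, rfl, rfl⟩

theorem GFbin_invariant : GFbin.{u}.InvariantForGFbinBisimulation := by
  intro φ M N α β F hF hmem
  exact hF.sat_iff φ.2 _ hmem α β fun x hx => ⟨x, hx, rfl⟩

/-- The translation `g φ` may have free variables that `φ` lacks, on which the given bisimulation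
says nothing. If `φ` has a free variable `z`, the extra ones are sent to the value of `z`. If it has
none, the two models are compared through their disjoint union, where the choice of assignment is
irrelevant to `φ`. -/
theorem AbstractLogic.invariant_of_extends {L : AbstractLogic.{u, v}}
    (h : GFbin.{u}.Extends L) : L.InvariantForGFbinBisimulation := by
  obtain ⟨g, hg⟩ := h
  intro φ M N α β F hF hmem
  rcases (L.fv φ).eq_empty_or_nonempty with h0 | ⟨z, hz⟩
  · have h₁ := GFbin_invariant.sat_iff_of_isCompatible (g φ) (isCompatible_inl M N) α
      (fun x => Sum.inl (α x)) fun _ _ => ⟨rfl, rfl⟩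
    have h₂ := GFbin_invariant.sat_iff_of_isCompatible (g φ) (isCompatible_inr M N) β
      (fun x => Sum.inr (β x)) fun _ _ => ⟨rfl, rfl⟩
    rw [hg, hg, h₁, h₂, ← hg, ← hg]
    exact L.sat_congr φ _ _ _ (by simp [h0])
  · classical
    let r : ℕ → ℕ := fun x => if x ∈ L.fv φ then x else z
    have hr : ∀ x, r x ∈ L.fv φ := by
      intro x
      by_cases hx : x ∈ L.fv φ <;> simp [r, hx, hz]
    have hr' : ∀ x ∈ L.fv φ, r x = x := fun x hx => by simp [r, hx]
    rw [L.sat_congr φ M α (α ∘ r) (fun x hx => by simp [hr' x hx]),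
      L.sat_congr φ N β (β ∘ r) (fun x hx => by simp [hr' x hx]), hg, hg]
    exact hF.sat_iff (g φ).2 _ hmem _ _ fun x _ => ⟨r x, hr x, rfl⟩

/-! ### Compactness of the binary guarded fragment -/

/-- The ultraproduct of a family of models. -/
abbrev Model.ultraproduct {I : Type} (U : Ultrafilter I) (M : I → Model.{u}) : Model.{u} where
  carrier := Quotient ((U : Filter I).productSetoid fun i => (M i).carrier)
  un n q := ∀ᶠ i in (U : Filter I), (M i).un n (q.out i)
  bin n q q' := ∀ᶠ i in (U : Filter I), (M i).bin n (q.out i) (q'.out i)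

theorem Model.eventually_out_mk {I : Type} (U : Ultrafilter I) (M : I → Model.{u})
    (d : ∀ i, (M i).carrier) : ∀ᶠ i in (U : Filter I),
      (Quotient.mk _ d : (Model.ultraproduct U M).carrier).out i = d i :=
  Quotient.mk_out (s := (U : Filter I).productSetoid fun i => (M i).carrier) d

/-- Łoś's theorem, with equivalence classes evaluated at the representatives chosen by `out`. -/
theorem RawFormula.sat_ultraproduct {I : Type} (U : Ultrafilter I) (M : I → Model.{u})
    (φ : RawFormula) : ∀ α : ℕ → (Model.ultraproduct U M).carrier,
      φ.Sat (Model.ultraproduct U M) α ↔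
        ∀ᶠ i in (U : Filter I), φ.Sat (M i) (fun x => (α x).out i) := by
  have atom : ∀ (A : Atom) (α : ℕ → (Model.ultraproduct U M).carrier),
      A.Sat (Model.ultraproduct U M) α ↔
        ∀ᶠ i in (U : Filter I), A.Sat (M i) (fun x => (α x).out i) := by
    intro A α
    cases A with
    | un i x => rfl
    | bin i x y => rfl
    | eq x y =>
      refine Iff.trans ?_ (Quotient.out_equiv_out
        (s := (U : Filter I).productSetoid fun i => (M i).carrier)).symm
      rfl
  induction φ with
  | atom A => exact atom A
  | neg φ ih => exact fun α => (not_congr (ih α)).trans Ultrafilter.eventually_not.symm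
  | or φ ψ ih₁ ih₂ => exact fun α => (or_congr (ih₁ α) (ih₂ α)).trans Ultrafilter.eventually_or.symm
  | ex y G ψ ih =>
    intro α
    have key : ∀ (q : (Model.ultraproduct U M).carrier) (i : I),
        (fun x => (Function.update α y q x).out i) =
          Function.update (fun x => (α x).out i) y (q.out i) := by
      intro q i
      funext x
      by_cases hx : x = y
      · subst hx; simp
      · simp [hx]
    constructor
    · rintro ⟨q, h₁, h₂⟩
      filter_upwards [(atom G _).1 h₁, (ih _).1 h₂] with i h₁ h₂
      rw [key] at h₁ h₂
      exact ⟨q.out i, h₁, h₂⟩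
    · intro h
      have : ∀ i, ∃ d : (M i).carrier, (RawFormula.ex y G ψ).Sat (M i) (fun x => (α x).out i) →
          G.Sat (M i) (Function.update (fun x => (α x).out i) y d) ∧
            ψ.Sat (M i) (Function.update (fun x => (α x).out i) y d) := by
        intro i
        by_cases hi : (RawFormula.ex y G ψ).Sat (M i) (fun x => (α x).out i)
        · obtain ⟨d, hd⟩ := hi
          exact ⟨d, fun _ => hd⟩
        -- An arbitrary element for the indices without a witness; these are negligible for `U`.
        · exact ⟨(α 0).out i, fun h => absurd h hi⟩
      choose d hd using this
      have hout := Model.eventually_out_mk U M d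
      refine ⟨Quotient.mk _ d, (atom G _).2 ?_, (ih _).2 ?_⟩
      · filter_upwards [h, hout] with i hi ho
        rw [key, ho]
        exact (hd i hi).1
      · filter_upwards [h, hout] with i hi ho
        rw [key, ho]
        exact (hd i hi).2

/-- The ultraproduct is indexed by finite sets of raw formulas rather than finite subsets of `S`, so
that the index type lies in the lowest universe and the carrier stays in `Type u`. -/
theorem AbstractLogic.compactness_of_extends {L : AbstractLogic.{u, v}}
    (h : GFbin.{u}.Extends L) : L.Compactness := by
  classical
  obtain ⟨g, hg⟩ := h
  intro S hS
  have hg' : ∀ φ M α, L.Sat φ M α ↔ (g φ).1.Sat M α := hg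
  have : ∀ i : Finset RawFormula, ∃ (M : Model.{u}) (α : ℕ → M.carrier),
      ∀ φ ∈ S, (g φ).1 ∈ i → L.Sat φ M α := by
    intro i
    -- Infinitely many members of `S` may share a translation. One representative for each
    -- translation in `i` gives a finite subset, and its model satisfies all the others too.
    have hc : ∀ χ : {χ // χ ∈ i ∧ ∃ φ ∈ S, (g φ).1 = χ}, ∃ φ ∈ S, (g φ).1 = χ.1 := fun χ => χ.2.2
    choose c hcS hcg using hc
    have : Finite {χ // χ ∈ i ∧ ∃ φ ∈ S, (g φ).1 = χ} :=
      (i.finite_toSet.subset fun χ (h : χ ∈ i ∧ ∃ φ ∈ S, (g φ).1 = χ) => h.1).to_subtype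
    obtain ⟨M, α, hM⟩ := hS (Set.range c) (by rintro _ ⟨χ, rfl⟩; exact hcS χ)
      (Set.finite_range c)
    refine ⟨M, α, fun φ hφ hi => ?_⟩
    have := hM _ ⟨⟨(g φ).1, hi, φ, hφ, rfl⟩, rfl⟩
    rw [hg', hcg] at this
    exact (hg' _ _ _).2 this
  choose M α hM using this
  let U : Ultrafilter (Finset RawFormula) := Ultrafilter.of Filter.atTop
  refine ⟨Model.ultraproduct U M, fun x => Quotient.mk _ fun i => α i x, fun φ hφ => ?_⟩
  rw [hg', RawFormula.sat_ultraproduct]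
  have h₁ : ∀ᶠ i in (U : Filter (Finset RawFormula)), (g φ).1 ∈ i :=
    Ultrafilter.of_le _ ((Filter.eventually_ge_atTop {(g φ).1}).mono fun i hi =>
      hi (Finset.mem_singleton_self _))
  have h₂ : ∀ᶠ i in (U : Filter (Finset RawFormula)), ∀ x ∈ (g φ).1.fv,
      (Quotient.mk _ fun i => α i x : (Model.ultraproduct U M).carrier).out i = α i x :=
    (Filter.eventually_all_finset _).2 fun x _ => Model.eventually_out_mk U M fun i => α i x
  filter_upwards [h₁, h₂] with i hi ho
  exact ((g φ).1.sat_congr (M i) _ _ ho).2 ((hg' _ _ _).1 (hM i φ hφ hi))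

/-! ### Properties definable in the binary guarded fragment -/

/-- A property of assignments that some formula of the binary guarded fragment with free variables
in `V` defines. -/
def IsDefinable (V : Finset ℕ) (P : ∀ M : Model.{u}, (ℕ → M.carrier) → Prop) : Prop :=
  ∃ φ : RawFormula, φ.IsGF ∧ φ.fv ⊆ V ∧ ∀ M α, φ.Sat M α ↔ P M α

namespace IsDefinable

variable {V W : Finset ℕ} {P Q : ∀ M : Model.{u}, (ℕ → M.carrier) → Prop}

theorem mono (h : IsDefinable V P) (hVW : V ⊆ W) : IsDefinable W P :=
  let ⟨φ, h₁, h₂, h₃⟩ := h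
  ⟨φ, h₁, h₂.trans hVW, h₃⟩

theorem congr (h : IsDefinable V P) (hPQ : ∀ M α, P M α ↔ Q M α) : IsDefinable V Q :=
  let ⟨φ, h₁, h₂, h₃⟩ := h
  ⟨φ, h₁, h₂, fun M α => (h₃ M α).trans (hPQ M α)⟩

theorem atom (A : Atom) (hA : A.vars ⊆ V) : IsDefinable.{u} V fun M α => A.Sat M α :=
  ⟨.atom A, trivial, hA, fun _ _ => Iff.rfl⟩

theorem un (i : ℕ) {x : ℕ} (hx : x ∈ V) : IsDefinable.{u} V fun M α => M.un i (α x) :=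
  atom (.un i x) (by simpa [Atom.vars])

theorem bin (i : ℕ) {x y : ℕ} (hx : x ∈ V) (hy : y ∈ V) :
    IsDefinable.{u} V fun M α => M.bin i (α x) (α y) :=
  atom (.bin i x y) (by simp [Atom.vars, Finset.insert_subset_iff, hx, hy])

theorem eq {x y : ℕ} (hx : x ∈ V) (hy : y ∈ V) : IsDefinable.{u} V fun _ α => α x = α y :=
  atom (.eq x y) (by simp [Atom.vars, Finset.insert_subset_iff, hx, hy])

theorem not (h : IsDefinable V P) : IsDefinable V fun M α => ¬ P M α :=
  let ⟨φ, h₁, h₂, h₃⟩ := h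
  ⟨φ.neg, h₁, h₂, fun M α => not_congr (h₃ M α)⟩

theorem or (hP : IsDefinable V P) (hQ : IsDefinable V Q) :
    IsDefinable V fun M α => P M α ∨ Q M α :=
  let ⟨φ, h₁, h₂, h₃⟩ := hP
  let ⟨ψ, h₁', h₂', h₃'⟩ := hQ
  ⟨φ.or ψ, ⟨h₁, h₁'⟩, Finset.union_subset h₂ h₂', fun M α => or_congr (h₃ M α) (h₃' M α)⟩

theorem and (hP : IsDefinable V P) (hQ : IsDefinable V Q) :
    IsDefinable V fun M α => P M α ∧ Q M α :=
  (hP.not.or hQ.not).not.congr fun _ _ => by tauto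

theorem iff (hP : IsDefinable V P) (hQ : IsDefinable V Q) :
    IsDefinable V fun M α => (P M α ↔ Q M α) :=
  ((hP.not.or hQ).and (hQ.not.or hP)).congr fun _ _ => by tauto

/-- The fragment has no closed formulas, so even a truth constant must mention a variable. This is
the source of the non-emptiness assumptions on `V`. -/
theorem const (hV : V.Nonempty) (p : Prop) : IsDefinable.{u} V fun _ _ => p := by
  obtain ⟨x, hx⟩ := hV
  have h : IsDefinable.{u} V fun _ α => α x = α x := eq hx hx
  by_cases hp : p
  · exact h.congr fun _ _ => by simp [hp]
  · exact h.not.congr fun _ _ => by simp [hp]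

theorem exists_finite (hV : V.Nonempty) {ι : Type*} [Finite ι]
    {P : ι → ∀ M : Model.{u}, (ℕ → M.carrier) → Prop} (h : ∀ i, IsDefinable V (P i)) :
    IsDefinable V fun M α => ∃ i, P i M α := by
  have key : ∀ s : Set ι, s.Finite → IsDefinable V fun M α => ∃ i ∈ s, P i M α := by
    intro s hs
    induction s, hs using Set.Finite.induction_on with
    | empty => exact (const hV False).congr fun _ _ => by simp
    | @insert a _ _ _ ih => exact ((h a).or ih).congr fun _ _ => by simp
  exact (key _ Set.finite_univ).congr fun _ _ => by simp

theorem forall_finite (hV : V.Nonempty) {ι : Type*} [Finite ι]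
    {P : ι → ∀ M : Model.{u}, (ℕ → M.carrier) → Prop} (h : ∀ i, IsDefinable V (P i)) :
    IsDefinable V fun M α => ∀ i, P i M α :=
  (exists_finite hV fun i => (h i).not).not.congr fun _ _ => by push Not; rfl

theorem exists_guard {x y : ℕ} (hxy : x ≠ y) {G : Atom} (hG : G.vars = {x, y})
    (h : IsDefinable {x, y} P) : IsDefinable {x} fun M α =>
      ∃ d, G.Sat M (Function.update α y d) ∧ P M (Function.update α y d) :=
  let ⟨φ, h₁, h₂, h₃⟩ := h
  ⟨.ex y G φ, ⟨⟨x, hxy, hG, h₂⟩, h₁⟩, by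
    intro z hz
    simp only [RawFormula.fv, hG, Finset.mem_erase, Finset.mem_union] at hz
    have := hz.2.elim id fun h => h₂ h
    simpa [hz.1] using this, fun M α => exists_congr fun d => and_congr Iff.rfl (h₃ _ _)⟩

theorem exists_bin {x y : ℕ} (hxy : x ≠ y) (i : ℕ) (dir : Bool)
    {P : ∀ M : Model.{u}, M.carrier → M.carrier → Prop}
    (h : IsDefinable {x, y} fun M α => P M (α x) (α y)) : IsDefinable {x} fun M α =>
      ∃ d, (if dir then M.bin i (α x) d else M.bin i d (α x)) ∧ P M (α x) d := by
  cases dir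
  · exact (h.exists_guard hxy (G := .bin i y x) (by simp [Atom.vars, Finset.pair_comm])).congr
      fun M α => by simp [Atom.Sat, hxy]
  · exact (h.exists_guard hxy (G := .bin i x y) (by simp [Atom.vars])).congr
      fun M α => by simp [Atom.Sat, hxy]

end IsDefinable

/-! ### Types of bounded rank over finitely many symbols -/

/-- Atomic types of pairs of elements over the first `k` binary symbols. -/
abbrev PairType (k : ℕ) : Type := Fin k → Prop × Prop

/-- Atomic types of elements over the first `k` unary and binary symbols. -/
abbrev PointType (k : ℕ) : Type := Fin k → Prop × Prop

/-- Types of rank `r` over the first `k` symbols. -/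
def RankType (k : ℕ) : ℕ → Type
  | 0 => PointType k
  | r + 1 => PointType k × Set (PairType k × RankType k r)

instance RankType.finite (k r : ℕ) : Finite (RankType k r) := by
  induction r with
  | zero => exact inferInstanceAs (Finite (PointType k))
  | succ r ih => exact inferInstanceAs (Finite (PointType k × Set (PairType k × RankType k r)))

namespace Model

def pairType (M : Model.{u}) (k : ℕ) (a b : M.carrier) : PairType k :=
  fun i => (M.bin i a b, M.bin i b a)

def pointType (M : Model.{u}) (k : ℕ) (a : M.carrier) : PointType k :=
  fun i => (M.un i a, M.bin i a a)

/-- Two elements are linked if one of the first `k` binary relations holds between them. -/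
def Linked (M : Model.{u}) (k : ℕ) (a b : M.carrier) : Prop :=
  ∃ i : Fin k, ∃ dir : Bool, if dir then M.bin i a b else M.bin i b a

/-- Only linked neighbours are recorded, since only these can be reached by a guarded quantifier.
The point itself is excluded because loops are already in `pointType` and a tree child must differ
from its parent. -/
def rankType (M : Model.{u}) (k : ℕ) : (r : ℕ) → M.carrier → RankType k r
  | 0, a => M.pointType k a
  | r + 1, a => (M.pointType k a,
      {p | ∃ b, M.Linked k a b ∧ b ≠ a ∧ M.pairType k a b = p.1 ∧ M.rankType k r b = p.2})

theorem pointType_eq_of_rankType_eq {M N : Model.{u}} {k r : ℕ} {a : M.carrier} {b : N.carrier}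
    (h : M.rankType k r a = N.rankType k r b) : M.pointType k a = N.pointType k b := by
  cases r with
  | zero => exact h
  | succ r => exact congrArg Prod.fst h

theorem exists_of_rankType_eq {M N : Model.{u}} {k r : ℕ} {a : M.carrier} {b : N.carrier}
    (h : M.rankType k (r + 1) a = N.rankType k (r + 1) b) {a' : M.carrier}
    (hl : M.Linked k a a') (hne : a' ≠ a) : ∃ b', b' ≠ b ∧
      M.pairType k a a' = N.pairType k b b' ∧ M.rankType k r a' = N.rankType k r b' := by
  have h₁ : (M.pairType k a a', M.rankType k r a') ∈ (M.rankType k (r + 1) a).2 :=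
    ⟨a', hl, hne, rfl, rfl⟩
  rw [h] at h₁
  obtain ⟨b', -, hb, h₂, h₃⟩ := h₁
  exact ⟨b', hb, h₂.symm, h₃.symm⟩

theorem un_iff_of_pointType_eq {M N : Model.{u}} {k i : ℕ} {a : M.carrier} {b : N.carrier}
    (h : M.pointType k a = N.pointType k b) (hi : i < k) : M.un i a ↔ N.un i b :=
  iff_of_eq (congrArg Prod.fst (congrFun h ⟨i, hi⟩))

theorem pairType_self_eq_of_pointType_eq {M N : Model.{u}} {k : ℕ} {a : M.carrier} {b : N.carrier}
    (h : M.pointType k a = N.pointType k b) : M.pairType k a a = N.pairType k b b :=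
  funext fun i => by
    have := congrArg Prod.snd (congrFun h i)
    exact Prod.ext this this

theorem bin_iff_of_pairType_eq {M N : Model.{u}} {k i : ℕ} {a a' : M.carrier} {b b' : N.carrier}
    (h : M.pairType k a a' = N.pairType k b b') (hi : i < k) :
    (M.bin i a a' ↔ N.bin i b b') ∧ (M.bin i a' a ↔ N.bin i b' b) :=
  ⟨iff_of_eq (congrArg Prod.fst (congrFun h ⟨i, hi⟩)),
    iff_of_eq (congrArg Prod.snd (congrFun h ⟨i, hi⟩))⟩

theorem pairType_swap_eq {M N : Model.{u}} {k : ℕ} {a a' : M.carrier} {b b' : N.carrier}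
    (h : M.pairType k a a' = N.pairType k b b') : M.pairType k a' a = N.pairType k b' b :=
  funext fun i => Prod.ext (congrArg Prod.snd (congrFun h i)) (congrArg Prod.fst (congrFun h i))

end Model

namespace IsDefinable

theorem pairType_eq {V : Finset ℕ} (k : ℕ) {x y : ℕ} (hx : x ∈ V) (hy : y ∈ V) (t : PairType k) :
    IsDefinable.{u} V fun M α => M.pairType k (α x) (α y) = t := by
  have hV : V.Nonempty := ⟨x, hx⟩
  refine (forall_finite hV fun i : Fin k =>
    ((bin.{u} i.1 hx hy).iff (const hV (t i).1)).and
      ((bin i.1 hy hx).iff (const hV (t i).2))).congr fun M α => ?_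
  simp only [funext_iff, Prod.ext_iff, Model.pairType, eq_iff_iff]

theorem pointType_eq {V : Finset ℕ} (k : ℕ) {x : ℕ} (hx : x ∈ V) (t : PointType k) :
    IsDefinable.{u} V fun M α => M.pointType k (α x) = t := by
  have hV : V.Nonempty := ⟨x, hx⟩
  refine (forall_finite hV fun i : Fin k =>
    ((un.{u} i.1 hx).iff (const hV (t i).1)).and
      ((bin i.1 hx hx).iff (const hV (t i).2))).congr fun M α => ?_
  simp only [funext_iff, Prod.ext_iff, Model.pointType, eq_iff_iff]

/-- There are finitely many candidates for a neighbour's type, so a set of them is described by a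
finite conjunction of guarded existentials and their negations. -/
theorem rankType_eq (k r : ℕ) : ∀ (x : ℕ) (t : RankType k r),
    IsDefinable.{u} {x} fun M α => M.rankType k r (α x) = t := by
  induction r with
  | zero => exact fun x t => pointType_eq k (by simp) t
  | succ r ih =>
    rintro x ⟨t, S⟩
    have hx : ({x} : Finset ℕ).Nonempty := ⟨x, by simp⟩
    have hxy : x ≠ x + 1 := by omega
    have hne : IsDefinable.{u} {x, x + 1} fun _ α => α (x + 1) ≠ α x :=
      (eq (by simp) (by simp)).not
    have hstep : ∀ (p : PairType k × RankType k r) (i : Fin k) (dir : Bool),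
        IsDefinable.{u} {x} fun M α => ∃ b,
          (if dir then M.bin i (α x) b else M.bin i b (α x)) ∧
            (b ≠ α x ∧ M.pairType k (α x) b = p.1 ∧ M.rankType k r b = p.2) := by
      intro p i dir
      refine exists_bin hxy i dir (P := fun M a b =>
        b ≠ a ∧ M.pairType k a b = p.1 ∧ M.rankType k r b = p.2) ?_
      exact hne.and ((pairType_eq k (by simp) (by simp) p.1).and
        ((ih (x + 1) p.2).mono (by simp)))
    refine ((pointType_eq.{u} k (V := {x}) (x := x) (by simp) t).and
      (forall_finite hx fun p : PairType k × RankType k r =>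
        (exists_finite hx fun i : Fin k => exists_finite hx fun dir : Bool =>
          hstep p i dir).iff (const hx (p ∈ S)))).congr fun M α => ?_
    refine Iff.trans (and_congr Iff.rfl ?_) Prod.mk_inj.symm
    rw [Set.ext_iff]
    refine forall_congr' fun p => iff_congr ?_ Iff.rfl
    simp only [Model.Linked, Set.mem_ofPred_eq]
    constructor
    · rintro ⟨i, dir, b, h₁, h₂⟩
      exact ⟨b, ⟨i, dir, h₁⟩, h₂⟩
    · rintro ⟨b, ⟨i, dir, h₁⟩, h₂⟩
      exact ⟨i, dir, b, h₁, h₂⟩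

end IsDefinable

/-- Pointed models with the same types of rank `k` over the first `k` symbols at the
variables in `V`, and with the same atomic types of pairs. -/
structure SameType (V : Finset ℕ) (k : ℕ) (M N : Model.{u}) (α : ℕ → M.carrier)
    (β : ℕ → N.carrier) : Prop where
  rank : ∀ x ∈ V, M.rankType k k (α x) = N.rankType k k (β x)
  pair : ∀ x ∈ V, ∀ y ∈ V, M.pairType k (α x) (α y) = N.pairType k (β x) (β y)
  eq_iff : ∀ x ∈ V, ∀ y ∈ V, (α x = α y ↔ β x = β y)

/-- The property is the disjunction of the finitely many types realised by pointed models that have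
it. -/
theorem isDefinable_of_sameType {V : Finset ℕ} (hV : V.Nonempty) (k : ℕ)
    {P : ∀ M : Model.{u}, (ℕ → M.carrier) → Prop}
    (h : ∀ M N α β, SameType V k M N α β → P M α → P N β) : IsDefinable V P := by
  let ty : ∀ M : Model.{u}, (ℕ → M.carrier) →
      (V → RankType k k) × (V → V → PairType k) × (V → V → Prop) := fun M α =>
    (fun x => M.rankType k k (α x), fun x y => M.pairType k (α x) (α y), fun x y => α x = α y)
  have hty : ∀ t, IsDefinable V fun M α => ty M α = t := by
    intro t
    refine ((IsDefinable.forall_finite hV fun x : V => (IsDefinable.rankType_eq.{u} k k x (t.1 x)).mono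
      (by simp)).and ((IsDefinable.forall_finite hV fun x : V => IsDefinable.forall_finite hV
        fun y : V => IsDefinable.pairType_eq k x.2 y.2 (t.2.1 x y)).and
        (IsDefinable.forall_finite hV fun x : V => IsDefinable.forall_finite hV fun y : V =>
          (IsDefinable.eq x.2 y.2).iff (IsDefinable.const hV (t.2.2 x y))))).congr fun M α => ?_
    simp only [ty, Prod.ext_iff, funext_iff, eq_iff_iff]
  refine (IsDefinable.exists_finite hV fun t : {t // ∃ M α, ty M α = t ∧ P M α} =>
    hty t.1).congr fun N β => ?_
  constructor
  · rintro ⟨⟨t, M, α, hM, hP⟩, ht⟩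
    have he : ty M α = ty N β := hM.trans ht.symm
    obtain ⟨h₁, h₂⟩ := Prod.mk.inj he
    obtain ⟨h₂, h₃⟩ := Prod.mk.inj h₂
    exact h M N α β ⟨fun x hx => congrFun h₁ ⟨x, hx⟩,
      fun x hx y hy => congrFun (congrFun h₂ ⟨x, hx⟩) ⟨y, hy⟩,
      fun x hx y hy => iff_of_eq (congrFun (congrFun h₃ ⟨x, hx⟩) ⟨y, hy⟩)⟩ hP
  · exact fun hP => ⟨⟨ty N β, N, β, rfl, hP⟩, rfl⟩

/-! ### The two sides of a model -/

/-- The reduct to the symbols of side `c`, relativised to the unary symbol marking that side. -/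
abbrev Model.side (T : Model.{u}) (c : Bool) : Model.{u} :=
  (T.relativise c.toNat).rename (fun i => 2 * i + 2 + c.toNat) (fun i => 2 * i + c.toNat)

/-- At the end of every path along the list `l` of directed symbols both sides are present and
agree on the `i`-th unary symbol, and they agree on the `i`-th binary symbol along the path. -/
def Model.Coincide (T : Model.{u}) (i : ℕ) : List (ℕ × Bool) → T.carrier → Prop
  | [], a => T.un 0 a ∧ T.un 1 a ∧ (T.un (2 * i + 2) a ↔ T.un (2 * i + 3) a)
  | (j, dir) :: l, a => ∀ b, (if dir then T.bin j a b else T.bin j b a) →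
      (T.bin (2 * i) a b ↔ T.bin (2 * i + 1) a b) ∧
        (T.bin (2 * i) b a ↔ T.bin (2 * i + 1) b a) ∧ T.Coincide i l b

theorem IsDefinable.coincide (i : ℕ) (l : List (ℕ × Bool)) : ∀ x : ℕ,
    IsDefinable.{u} {x} fun T α => T.Coincide i l (α x) := by
  induction l with
  | nil =>
    exact fun x => (un _ (by simp)).and ((un _ (by simp)).and ((un _ (by simp)).iff
      (un _ (by simp))))
  | cons p l ih =>
    obtain ⟨j, dir⟩ := p
    intro x
    have hxy : x ≠ x + 1 := by omega
    refine (exists_bin hxy j dir (P := fun T a b =>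
      ¬ ((T.bin (2 * i) a b ↔ T.bin (2 * i + 1) a b) ∧
        (T.bin (2 * i) b a ↔ T.bin (2 * i + 1) b a) ∧ T.Coincide i l b))
      (IsDefinable.not (((bin _ (by simp) (by simp)).iff (bin _ (by simp) (by simp))).and
        (((bin _ (by simp) (by simp)).iff (bin _ (by simp) (by simp))).and
          ((ih (x + 1)).mono (by simp)))))).not.congr fun T α => ?_
    simp only [Model.Coincide, not_exists, not_and_not_right]

/-- The identity on the points from which everything reachable coincides on the two sides generates
a bisimulation between the two sides. -/
theorem isCompatible_side (T : Model.{u}) :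
    IsCompatible (T.side false) (T.side true) fun p q =>
      p.1.1 = p.2.1 ∧ q.1.1 = q.2.1 ∧ (∀ i l, T.Coincide i l p.1.1) ∧
        (∀ i l, T.Coincide i l q.1.1) ∧ ∀ i,
          (T.bin (2 * i) p.1.1 q.1.1 ↔ T.bin (2 * i + 1) p.1.1 q.1.1) ∧
            (T.bin (2 * i) q.1.1 p.1.1 ↔ T.bin (2 * i + 1) q.1.1 p.1.1) := by
  have key : ∀ (a b : T.carrier), (∀ i l, T.Coincide i l a) → ∀ (j : ℕ) (dir : Bool),
      (if dir then T.bin j a b else T.bin j b a) →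
      T.un 0 b ∧ T.un 1 b ∧ (∀ i l, T.Coincide i l b) ∧
      (∀ i, (T.bin (2 * i) a b ↔ T.bin (2 * i + 1) a b) ∧
        (T.bin (2 * i) b a ↔ T.bin (2 * i + 1) b a)) ∧
      ∀ i, (T.bin (2 * i) b b ↔ T.bin (2 * i + 1) b b) ∧
        (T.bin (2 * i) b b ↔ T.bin (2 * i + 1) b b) := by
    intro a b ha j dir hab
    have hb : ∀ i l, T.Coincide i l b := fun i l => (ha i ((j, dir) :: l) b hab).2.2
    -- The empty path says nothing about loops, but a loop present on either side can itself be
    -- walked as a path of length one, along which the sides agree.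
    have hbb : ∀ i, T.bin (2 * i) b b ↔ T.bin (2 * i + 1) b b := fun i =>
      ⟨fun h => (hb i [(2 * i, true)] b (by simpa using h)).1.1 h,
        fun h => (hb i [(2 * i + 1, true)] b (by simpa using h)).1.2 h⟩
    exact ⟨(hb 0 []).1, (hb 0 []).2.1, hb,
      fun i => ⟨(ha i [(j, dir)] b hab).1, (ha i [(j, dir)] b hab).2.1⟩,
      fun i => ⟨hbb i, hbb i⟩⟩
  refine ⟨?_, ?_, ?_, ?_, ?_, ?_⟩
  · rintro p q ⟨h₁, h₂, h₃, h₄, h₅⟩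
    exact ⟨h₂, h₁, h₄, h₃, fun i => (h₅ i).symm⟩
  · rintro ⟨⟨a, ha⟩, ⟨a', ha'⟩⟩ ⟨⟨b, hb⟩, ⟨b', hb'⟩⟩ ⟨h₁, h₂, -⟩
    obtain rfl : a = a' := h₁
    obtain rfl : b = b' := h₂
    constructor <;> intro h
    · have hab : a = b := congrArg Subtype.val h
      exact Subtype.ext hab
    · have hab : a = b := congrArg Subtype.val h
      exact Subtype.ext hab
  · rintro ⟨⟨a, ha⟩, ⟨a', ha'⟩⟩ ⟨h₁, -, h₃, -⟩ i
    obtain rfl : a = a' := h₁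
    exact (h₃ i []).2.2
  · rintro ⟨⟨a, ha⟩, ⟨a', ha'⟩⟩ ⟨⟨b, hb⟩, ⟨b', hb'⟩⟩ ⟨h₁, h₂, -, -, h₅⟩ i
    obtain rfl : a = a' := h₁
    obtain rfl : b = b' := h₂
    exact (h₅ i).1
  · rintro ⟨⟨a, ha⟩, ⟨a', ha'⟩⟩ ⟨b, hb⟩ ⟨h₁, -, h₃, -, -⟩ i h
    obtain rfl : a = a' := h₁
    have : ∃ dir : Bool, if dir then T.bin (2 * i) a b else T.bin (2 * i) b a := by
      rcases h with h | h
      · exact ⟨true, h⟩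
      · exact ⟨false, h⟩
    obtain ⟨dir, hab⟩ := this
    obtain ⟨k₀, k₁, k₂, k₃, k₄⟩ := key a b h₃ _ dir hab
    exact ⟨⟨b, k₁⟩, ⟨rfl, rfl, h₃, k₂, k₃⟩, rfl, rfl, k₂, k₂, k₄⟩
  · rintro ⟨⟨a, ha⟩, ⟨a', ha'⟩⟩ ⟨b, hb⟩ ⟨h₁, -, h₃, -, -⟩ i h
    obtain rfl : a = a' := h₁
    have : ∃ dir : Bool, if dir then T.bin (2 * i + 1) a b else T.bin (2 * i + 1) b a := by
      rcases h with h | h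
      · exact ⟨true, h⟩
      · exact ⟨false, h⟩
    obtain ⟨dir, hab⟩ := this
    obtain ⟨k₀, k₁, k₂, k₃, k₄⟩ := key a b h₃ _ dir hab
    exact ⟨⟨b, k₀⟩, ⟨rfl, rfl, h₃, k₂, k₃⟩, rfl, rfl, k₂, k₂, k₄⟩

/-! ### The joint tree of two models -/

/-- A label of the joint tree lies on both sides, with a rank, or on one side only. -/
inductive Kind : Type where
  | both (r : ℕ)
  | only (c : Bool)

/-- Labels of the joint tree of the models `X false` and `X true`. -/
structure Label (X : Bool → Model.{u}) : Type u where
  el : ∀ c, (X c).carrier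
  kind : Kind

/-- Finite non-empty sequences, as nodes of a forest. -/
inductive Node (Q : Type u) : Type u where
  | root (q : Q)
  | child (s : Node Q) (q : Q)

namespace Node

def lab {Q : Type u} : Node Q → Q
  | root q => q
  | child _ q => q

/-- Nodes are adjacent if they are equal, both roots, or parent and child. -/
def Adj {Q : Type u} (s t : Node Q) : Prop :=
  s = t ∨ (∃ p q, s = root p ∧ t = root q) ∨ (∃ q, t = child s q) ∨ ∃ q, s = child t q

theorem Adj.symm {Q : Type u} {s t : Node Q} (h : s.Adj t) : t.Adj s := by
  rcases h with h | ⟨p, q, h₁, h₂⟩ | h | h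
  · exact Or.inl h.symm
  · exact Or.inr (Or.inl ⟨q, p, h₂, h₁⟩)
  · exact Or.inr (Or.inr (Or.inr h))
  · exact Or.inr (Or.inr (Or.inl h))

variable {X : Bool → Model.{u}}

/-- The labels allowed below a given label: either the rank decreases and the two sides match, or
only one side continues, which below positive rank happens for elements that are not linked. -/
def Step (k : ℕ) (p q : Label X) : Prop :=
  (∃ r, p.kind = .both (r + 1) ∧ q.kind = .both r ∧ (∀ c, q.el c ≠ p.el c) ∧ ∀ c c',
    (X c).pairType k (p.el c) (q.el c) = (X c').pairType k (p.el c') (q.el c') ∧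
      (X c).rankType k r (q.el c) = (X c').rankType k r (q.el c')) ∨
  ∃ c, q.kind = .only c ∧ p.kind ≠ .only (!c) ∧ q.el c ≠ p.el c ∧
    ∀ r, p.kind = .both (r + 1) → ¬ (X c).Linked k (p.el c) (q.el c)

def Valid (k : ℕ) (α : ∀ c, ℕ → (X c).carrier) : Node (Label X) → Prop
  | root q => ∃ x, q = ⟨fun c => α c x, .both k⟩
  | child s q => s.Valid k α ∧ Step k s.lab q

/-- Nodes that are not valid lie on neither side and carry no edges, so relativisation discards
them. -/
def OnSide (k : ℕ) (α : ∀ c, ℕ → (X c).carrier) (c : Bool) (s : Node (Label X)) : Prop :=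
  s.Valid k α ∧ s.lab.kind ≠ .only (!c)

end Node

/-- Assignments in two models with the same types of rank `k` over the first `k` symbols. -/
structure IsMatched (X : Bool → Model.{u}) (k : ℕ) (α : ∀ c, ℕ → (X c).carrier) : Prop where
  rank : ∀ x c c', (X c).rankType k k (α c x) = (X c').rankType k k (α c' x)
  pair : ∀ x y c c',
    (X c).pairType k (α c x) (α c y) = (X c').pairType k (α c' x) (α c' y)
  eq_iff : ∀ x y c c', α c x = α c y → α c' x = α c' y

section Tree

variable {X : Bool → Model.{u}} {k : ℕ} {α : ∀ c, ℕ → (X c).carrier}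

theorem Node.Valid.rankType_eq (hα : IsMatched X k α) {s : Node (Label X)} (hs : s.Valid k α)
    {r : ℕ} (hr : s.lab.kind = .both r) (c c' : Bool) :
    (X c).rankType k r (s.lab.el c) = (X c').rankType k r (s.lab.el c') := by
  cases s with
  | root q =>
    obtain ⟨x, rfl⟩ := hs
    obtain rfl : k = r := Kind.both.inj hr
    exact hα.rank x c c'
  | child s q =>
    rcases hs.2 with ⟨r', -, h₂, -, h₃⟩ | ⟨d, h, -⟩
    · obtain rfl : r' = r := Kind.both.inj (h₂.symm.trans hr)
      exact (h₃ c c').2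
    · cases h.symm.trans hr

theorem Node.OnSide.el_ne_of_child {s : Node (Label X)} {q : Label X} {c : Bool}
    (h : (s.child q).OnSide k α c) : q.el c ≠ s.lab.el c := by
  rcases h.1.2 with ⟨r, -, -, h₃, -⟩ | ⟨d, h₁, -, h₃, -⟩
  · exact h₃ c
  · have : d = c := by
      have := h.2
      rw [show (s.child q).lab = q from rfl, h₁] at this
      cases c <;> cases d <;> simp_all
    subst this
    exact h₃

/-- A child differs from its parent on every side where it lives. For two roots, equality of
elements in one model forces it in the other by matching, so the whole labels agree. -/
theorem Node.Adj.eq_iff (hα : IsMatched X k α) {s t : Node (Label X)} {c : Bool}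
    (hs : s.OnSide k α c) (ht : t.OnSide k α c) (h : s.Adj t) :
    s = t ↔ s.lab.el c = t.lab.el c := by
  refine ⟨fun h => h ▸ rfl, fun he => ?_⟩
  rcases h with h | ⟨p, q, rfl, rfl⟩ | ⟨q, rfl⟩ | ⟨q, rfl⟩
  · exact h
  · obtain ⟨x, rfl⟩ := hs.1
    obtain ⟨y, rfl⟩ := ht.1
    have : (fun c => α c x) = fun c => α c y := funext fun c' => hα.eq_iff x y c c' he
    rw [this]
  · exact absurd he.symm (Node.OnSide.el_ne_of_child ht)
  · exact absurd he (Node.OnSide.el_ne_of_child hs)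

theorem Node.OnSide.exists_adj (hα : IsMatched X k α) {s : Node (Label X)} {c : Bool}
    (hs : s.OnSide k α c) (d : (X c).carrier) :
    ∃ t : Node (Label X), t.OnSide k α c ∧ s.Adj t ∧ t.lab.el c = d := by
  classical
  by_cases hd : d = s.lab.el c
  · exact ⟨s, hs, Or.inl rfl, hd.symm⟩
  by_cases hl : ∃ r, s.lab.kind = .both (r + 1) ∧ (X c).Linked k (s.lab.el c) d
  · obtain ⟨r, hr, hl⟩ := hl
    have : ∀ c', ∃ d', d' ≠ s.lab.el c' ∧
        (X c).pairType k (s.lab.el c) d = (X c').pairType k (s.lab.el c') d' ∧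
        (X c).rankType k r d = (X c').rankType k r d' := fun c' =>
      Model.exists_of_rankType_eq (hs.1.rankType_eq hα hr c c') hl hd
    choose d' h₁ h₂ h₃ using this
    -- The chosen `d'` need not take the value `d` at `c`; overwriting that coordinate makes the new
    -- node project to `d` itself.
    have hu : ∀ c', Function.update d' c d c' ≠ s.lab.el c' ∧
        (X c').pairType k (s.lab.el c') (Function.update d' c d c') =
          (X c).pairType k (s.lab.el c) d ∧
        (X c').rankType k r (Function.update d' c d c') = (X c).rankType k r d := by
      intro c'
      by_cases hc : c' = c
      · subst hc
        simpa using hd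
      · rw [Function.update_of_ne hc]
        exact ⟨h₁ c', (h₂ c').symm, (h₃ c').symm⟩
    refine ⟨s.child ⟨Function.update d' c d, .both r⟩, ⟨⟨hs.1, Or.inl ⟨r, hr, rfl, fun c' =>
      (hu c').1, fun c' c'' => ⟨(hu c').2.1.trans (hu c'').2.1.symm,
        (hu c').2.2.trans (hu c'').2.2.symm⟩⟩⟩, ?_⟩, Or.inr (Or.inr (Or.inl ⟨_, rfl⟩)), ?_⟩
    · simp [Node.lab]
    · simp [Node.lab]
  -- The coordinate of the other side is a dummy, as the new node is not on that side.
  · refine ⟨s.child ⟨Function.update s.lab.el c d, .only c⟩, ⟨⟨hs.1, Or.inr ⟨c, rfl, hs.2, ?_, ?_⟩⟩,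
      ?_⟩, Or.inr (Or.inr (Or.inl ⟨_, rfl⟩)), ?_⟩
    · simpa using hd
    · intro r hr hl'
      exact hl ⟨r, hr, by simpa using hl'⟩
    · simp [Node.lab]
    · simp [Node.lab]

/-- Below positive rank, one-sided children are never linked to their parent, so an edge among the
first `k` symbols leads to a two-sided node. Going down costs one rank, going up gains one, and
roots all have rank `k`. -/
theorem Node.Adj.exists_both (hα : IsMatched X k α) {s t : Node (Label X)} {c : Bool} {r : ℕ}
    (hs : s.Valid k α) (hr : s.lab.kind = .both (r + 1)) (ht : t.OnSide k α c) (h : s.Adj t)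
    (hl : (X c).Linked k (s.lab.el c) (t.lab.el c)) :
    ∃ r', r ≤ r' ∧ t.lab.kind = .both r' ∧ ∀ c c',
      (X c).pairType k (s.lab.el c) (t.lab.el c) =
        (X c').pairType k (s.lab.el c') (t.lab.el c') := by
  rcases h with rfl | ⟨p, q, rfl, rfl⟩ | ⟨q, rfl⟩ | ⟨q, rfl⟩
  · exact ⟨r + 1, by omega, hr, fun c c' => Model.pairType_self_eq_of_pointType_eq
      (Model.pointType_eq_of_rankType_eq (hs.rankType_eq hα hr c c'))⟩
  · obtain ⟨x, rfl⟩ := hs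
    obtain ⟨y, rfl⟩ := ht.1
    have hk : k = r + 1 := Kind.both.inj hr
    exact ⟨k, by omega, rfl, hα.pair x y⟩
  · rcases ht.1.2 with ⟨r', h₁, h₂, -, h₃⟩ | ⟨d, h₁, -, -, h₃⟩
    · have : r' + 1 = r + 1 := Kind.both.inj (h₁.symm.trans hr)
      exact ⟨r', by omega, h₂, fun c c' => (h₃ c c').1⟩
    · have : d = c := by
        have := ht.2
        rw [show (s.child q).lab = q from rfl, h₁] at this
        cases c <;> cases d <;> simp_all
      subst this
      exact absurd hl (h₃ r hr)
  · rcases hs.2 with ⟨r', h₁, h₂, -, h₃⟩ | ⟨d, h₁, -⟩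
    · have : r' = r + 1 := Kind.both.inj (h₂.symm.trans hr)
      exact ⟨r' + 1, by omega, h₁, fun c c' => Model.pairType_swap_eq (h₃ c c').1⟩
    · cases h₁.symm.trans hr

variable (X k α) in
/-- The joint tree. Its two sides are bisimilar to the two given models. -/
abbrev jointTree : Model.{u} where
  carrier := Node (Label X)
  un n s := (∃ c : Bool, n = c.toNat ∧ s.OnSide k α c) ∨
    ∃ (c : Bool) (i : ℕ), n = 2 * i + 2 + c.toNat ∧ (X c).un i (s.lab.el c)
  bin n s t := ∃ (c : Bool) (i : ℕ), n = 2 * i + c.toNat ∧ s.OnSide k α c ∧ t.OnSide k α c ∧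
    s.Adj t ∧ (X c).bin i (s.lab.el c) (t.lab.el c)

theorem jointTree_mark (c : Bool) (s : Node (Label X)) :
    (jointTree X k α).un c.toNat s ↔ s.OnSide k α c := by
  constructor
  · rintro (⟨c', h, hs⟩ | ⟨c', i, h, -⟩)
    · cases c <;> cases c' <;> simp_all
    · cases c <;> cases c' <;> simp at h
  · exact fun h => Or.inl ⟨c, rfl, h⟩

theorem jointTree_un (c : Bool) (i : ℕ) (s : Node (Label X)) :
    (jointTree X k α).un (2 * i + 2 + c.toNat) s ↔ (X c).un i (s.lab.el c) := by
  constructor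
  · rintro (⟨c', h, -⟩ | ⟨c', i', h, hs⟩)
    · cases c <;> cases c' <;> simp at h
    · have : c = c' ∧ i = i' := by cases c <;> cases c' <;> simp at h ⊢ <;> omega
      obtain ⟨rfl, rfl⟩ := this
      exact hs
  · exact fun h => Or.inr ⟨c, i, rfl, h⟩

theorem jointTree_bin (c : Bool) (i : ℕ) (s t : Node (Label X)) :
    (jointTree X k α).bin (2 * i + c.toNat) s t ↔ s.OnSide k α c ∧ t.OnSide k α c ∧
      s.Adj t ∧ (X c).bin i (s.lab.el c) (t.lab.el c) := by
  constructor
  · rintro ⟨c', i', h, hs⟩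
    have : c = c' ∧ i = i' := by cases c <;> cases c' <;> simp at h ⊢ <;> omega
    obtain ⟨rfl, rfl⟩ := this
    exact hs
  · exact fun h => ⟨c, i, rfl, h⟩

/-- Each side unravels its model: edges are pulled back along the projection, but only between
adjacent nodes, and every element of the model is the projection of some node adjacent to a given
one. The mutual adjacency of roots keeps all relations among the assigned values. -/
theorem isCompatible_jointTree (hα : IsMatched X k α) (c : Bool) :
    IsCompatible ((jointTree X k α).side c) (X c) fun p q =>
      p.2 = p.1.1.lab.el c ∧ q.2 = q.1.1.lab.el c ∧ p.1.1.Adj q.1.1 := by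
  refine ⟨?_, ?_, ?_, ?_, ?_, ?_⟩
  · rintro p q ⟨h₁, h₂, h₃⟩
    exact ⟨h₂, h₁, h₃.symm⟩
  · rintro ⟨⟨s, hs⟩, a⟩ ⟨⟨t, ht⟩, b⟩ ⟨h₁, h₂, h⟩
    obtain rfl : a = (Node.lab s).el c := h₁
    obtain rfl : b = (Node.lab t).el c := h₂
    exact Subtype.ext_iff.trans
      (h.eq_iff hα ((jointTree_mark c s).1 hs) ((jointTree_mark c t).1 ht))
  · rintro ⟨⟨s, hs⟩, a⟩ ⟨h₁, -⟩ i
    obtain rfl : a = (Node.lab s).el c := h₁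
    exact jointTree_un c i s
  · rintro ⟨⟨s, hs⟩, a⟩ ⟨⟨t, ht⟩, b⟩ ⟨h₁, h₂, h⟩ i
    obtain rfl : a = (Node.lab s).el c := h₁
    obtain rfl : b = (Node.lab t).el c := h₂
    refine (jointTree_bin c i s t).trans ⟨fun h => h.2.2.2, fun h' => ?_⟩
    exact ⟨(jointTree_mark c s).1 hs, (jointTree_mark c t).1 ht, h, h'⟩
  · rintro ⟨⟨s, hs⟩, a⟩ ⟨t, ht⟩ ⟨h₁, -⟩ i h
    obtain rfl : a = (Node.lab s).el c := h₁
    have hst : s.Adj t := by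
      rcases h with h | h
      · exact ((jointTree_bin c i s t).1 h).2.2.1
      · exact ((jointTree_bin c i t s).1 h).2.2.1.symm
    exact ⟨t.lab.el c, ⟨rfl, rfl, hst⟩, rfl, rfl, Or.inl rfl⟩
  · rintro ⟨⟨s, hs⟩, a⟩ d ⟨h₁, -⟩ i -
    obtain rfl : a = (Node.lab s).el c := h₁
    obtain ⟨t, h₁, h₂, rfl⟩ := ((jointTree_mark c s).1 hs).exists_adj hα d
    exact ⟨⟨t, (jointTree_mark c t).2 h₁⟩, ⟨rfl, rfl, h₂⟩, rfl, rfl, Or.inl rfl⟩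

theorem Node.Valid.onSide {s : Node (Label X)} (hs : s.Valid k α) {r : ℕ}
    (hr : s.lab.kind = .both r) (c : Bool) : s.OnSide k α c :=
  ⟨hs, by rw [hr]; exact fun h => by cases h⟩

theorem jointTree_bin_iff {s t : Node (Label X)} (hs : s.Valid k α) (ht : t.Valid k α) {r r' : ℕ}
    (hr : s.lab.kind = .both r) (hr' : t.lab.kind = .both r')
    (h : ∀ c c', (X c).pairType k (s.lab.el c) (t.lab.el c) =
      (X c').pairType k (s.lab.el c') (t.lab.el c')) {i : ℕ} (hi : i < k) :
    (jointTree X k α).bin (2 * i) s t ↔ (jointTree X k α).bin (2 * i + 1) s t := by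
  refine (jointTree_bin false i s t).trans (Iff.trans ?_ (jointTree_bin true i s t).symm)
  simp only [hs.onSide hr, ht.onSide hr', true_and]
  exact and_congr Iff.rfl (Model.bin_iff_of_pairType_eq (h false true) hi).1

/-- Each step of the path uses up at most one rank, so rank at least the length keeps every node on
the path two-sided. -/
theorem jointTree_coincide (hα : IsMatched X k α) {i : ℕ} (hi : i < k) (l : List (ℕ × Bool)) :
    (∀ p ∈ l, p.1 < k) → ∀ (s : Node (Label X)) (r : ℕ), s.Valid k α → s.lab.kind = .both r →
      l.length ≤ r → (jointTree X k α).Coincide i l s := by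
  induction l with
  | nil =>
    intro _ s r hs hr _
    refine ⟨(jointTree_mark false s).2 (hs.onSide hr _), (jointTree_mark true s).2 (hs.onSide hr _),
      (jointTree_un false i s).trans (Iff.trans ?_ (jointTree_un true i s).symm)⟩
    exact Model.un_iff_of_pointType_eq
      (Model.pointType_eq_of_rankType_eq (hs.rankType_eq hα hr false true)) hi
  | cons p l ih =>
    obtain ⟨j, dir⟩ := p
    rintro hl s r hs hr hlen t hst
    obtain ⟨r, rfl⟩ : ∃ r₀, r = r₀ + 1 := ⟨r - 1, by simp at hlen; omega⟩
    have hj : j < k := hl (j, dir) (by simp)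
    have : ∃ c, t.OnSide k α c ∧ s.Adj t ∧ (X c).Linked k (s.lab.el c) (t.lab.el c) := by
      cases dir
      · obtain ⟨c, n, rfl, h₁, h₂, h₃, h₄⟩ := hst
        exact ⟨c, h₁, h₃.symm, ⟨n, by omega⟩, false, h₄⟩
      · obtain ⟨c, n, rfl, h₁, h₂, h₃, h₄⟩ := hst
        exact ⟨c, h₂, h₃, ⟨n, by omega⟩, true, h₄⟩
    obtain ⟨c, ht, hadj, hlink⟩ := this
    obtain ⟨r', hrr', hr', hp⟩ := hadj.exists_both hα hs hr ht hlink
    exact ⟨jointTree_bin_iff hs ht.1 hr hr' hp hi, jointTree_bin_iff ht.1 hs hr' hr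
      (fun c c' => Model.pairType_swap_eq (hp c c')) hi,
      ih (fun p hp => hl p (by simp [hp])) t r' ht.1 hr' (by simp at hlen; omega)⟩

end Tree

/-! ### The characterisation -/

theorem AbstractLogic.Compactness.of_eventually {L : AbstractLogic.{u, v}} (hL : L.Compactness)
    (S : Set L.Fml) (T : ℕ → Model.{u}) (γ : ∀ k, ℕ → (T k).carrier)
    (h : ∀ φ ∈ S, ∀ᶠ k in Filter.atTop, L.Sat φ (T k) (γ k)) : L.Satisfiable S := by
  refine hL S fun S' hS' hfin => ?_
  obtain ⟨k, hk⟩ := ((Filter.eventually_all_finite hfin).2 fun φ hφ => h φ (hS' hφ)).exists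
  exact ⟨T k, γ k, hk⟩

theorem AbstractLogic.exists_side (L : AbstractLogic.{u, v}) (φ : L.Fml) (c : Bool) :
    ∃ ψ : L.Fml, ∀ (T : Model.{u}) (γ : ℕ → T.carrier) (h : ∀ x, T.un c.toNat (γ x)),
      L.Sat ψ T γ ↔ L.Sat φ (T.side c) fun x => ⟨γ x, h x⟩ := by
  obtain ⟨χ, hχ⟩ := L.exists_rename (fun i => 2 * i + 2 + c.toNat) (fun i => 2 * i + c.toNat) φ
  obtain ⟨ψ, hψ⟩ := L.exists_relativise c.toNat χ
  exact ⟨ψ, fun T γ h => (hψ T fun x => ⟨γ x, h x⟩).trans (hχ _ _)⟩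

theorem AbstractLogic.not_forall_exists_isMatched {L : AbstractLogic.{u, v}}
    (hL : L.Extends GFbin.{u}) (hc : L.Compactness) (hi : L.InvariantForGFbinBisimulation)
    (φ : L.Fml) : ¬ ∀ k, ∃ (X : Bool → Model.{u}) (α : ∀ c, ℕ → (X c).carrier),
      IsMatched X k α ∧ L.Sat φ (X false) (α false) ∧ ¬ L.Sat φ (X true) (α true) := by
  intro hX
  choose X α hα hf ht using hX
  obtain ⟨g, hg⟩ := hL
  have hdef : ∀ {V P}, IsDefinable.{u} V P → ∃ ψ : L.Fml, ∀ M α, L.Sat ψ M α ↔ P M α :=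
    fun ⟨χ, h₁, _, h₃⟩ => ⟨g ⟨χ, h₁⟩, fun M α => (hg _ M α).symm.trans (h₃ M α)⟩
  choose θ hθ using L.exists_side φ
  obtain ⟨θ', hθ'⟩ := L.exists_neg (θ true)
  choose κ hκ using fun (p : ℕ × List (ℕ × Bool) × ℕ) =>
    hdef (IsDefinable.coincide.{u} p.1 p.2.1 p.2.2)
  choose ε hε using fun (p : ℕ × ℕ × ℕ) => hdef
    ((IsDefinable.bin.{u} (V := {p.2.1, p.2.2}) (2 * p.1) (x := p.2.1) (y := p.2.2)
      (by simp) (by simp)).iff (IsDefinable.bin (2 * p.1 + 1) (x := p.2.1) (y := p.2.2)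
        (by simp) (by simp)))
  let γ : ∀ k, ℕ → (jointTree (X k) k (α k)).carrier := fun k x =>
    Node.root ⟨fun c => α k c x, .both k⟩
  have hγ : ∀ k x, (γ k x).Valid k (α k) := fun k x => ⟨x, rfl⟩
  have hside : ∀ k c, L.Sat (θ c) (jointTree (X k) k (α k)) (γ k) ↔
      L.Sat φ (X k c) (α k c) := fun k c =>
    (hθ c _ _ fun x => (jointTree_mark c _).2 ((hγ k x).onSide rfl c)).trans
      (hi.sat_iff_of_isCompatible φ (isCompatible_jointTree (hα k) c) _ _ fun x y =>
        ⟨rfl, rfl, Or.inr (Or.inl ⟨_, _, rfl, rfl⟩)⟩)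
  obtain ⟨T, δ, hT⟩ := hc.of_eventually ({θ false, θ'} ∪ Set.range κ ∪ Set.range ε)
    (fun k => jointTree (X k) k (α k)) γ (by
      rintro ψ (((rfl | rfl) | ⟨⟨i, l, x⟩, rfl⟩) | ⟨⟨i, x, y⟩, rfl⟩)
      · exact Filter.Eventually.of_forall fun k => (hside k false).2 (hf k)
      · exact Filter.Eventually.of_forall fun k =>
          (hθ' _ _).2 fun h => ht k ((hside k true).1 h)
      -- The sum of the symbols on the path is a crude bound for each of them.
      · filter_upwards [Filter.eventually_gt_atTop i, Filter.eventually_ge_atTop l.length,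
          Filter.eventually_gt_atTop (l.map Prod.fst).sum] with k h₁ h₂ h₃
        exact (hκ _ _ _).2 (jointTree_coincide (hα k) h₁ l (fun p hp =>
          (List.le_sum_of_mem (List.mem_map_of_mem hp)).trans_lt h₃) _ k (hγ k x) rfl h₂)
      · filter_upwards [Filter.eventually_gt_atTop i] with k h₁
        exact (hε _ _ _).2 (jointTree_bin_iff (hγ k x) (hγ k y) rfl rfl ((hα k).pair x y) h₁))
  have hco : ∀ x i l, T.Coincide i l (δ x) := fun x i l =>
    (hκ (i, l, x) T δ).1 (hT _ (Or.inl (Or.inr ⟨_, rfl⟩)))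
  have hbin : ∀ x y i, T.bin (2 * i) (δ x) (δ y) ↔ T.bin (2 * i + 1) (δ x) (δ y) := fun x y i =>
    (hε (i, x, y) T δ).1 (hT _ (Or.inr ⟨_, rfl⟩))
  have h₀ : ∀ x, T.un false.toNat (δ x) := fun x => (hco x 0 []).1
  have h₁ : ∀ x, T.un true.toNat (δ x) := fun x => (hco x 0 []).2.1
  refine (hθ' T δ).1 (hT _ (by simp)) ((hθ true T δ h₁).2 ?_)
  refine (hi.sat_iff_of_isCompatible φ (isCompatible_side T) _ _ fun x y => ?_).1
    ((hθ false T δ h₀).1 (hT _ (by simp)))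
  exact ⟨rfl, rfl, hco x, hco y, fun i => ⟨hbin x y i, hbin y x i⟩⟩

theorem AbstractLogic.isDefinable_sat {L : AbstractLogic.{u, v}}
    (hL : L.Extends GFbin.{u}) (hc : L.Compactness) (hi : L.InvariantForGFbinBisimulation)
    (φ : L.Fml) : IsDefinable (insert 0 (L.fv φ)) fun M α => L.Sat φ M α := by
  by_contra hφ
  refine L.not_forall_exists_isMatched hL hc hi φ fun k => ?_
  have hV : (insert 0 (L.fv φ)).Nonempty := ⟨0, by simp⟩
  by_contra hno
  refine hφ (isDefinable_of_sameType hV k fun M N α β h hM => ?_)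
  by_contra hN
  -- Matching concerns all variables, but the types agree only on a finite set. Redirecting the
  -- other variables to 0 brings every value into that set without affecting `φ`.
  let ρ : ℕ → ℕ := fun x => if x ∈ L.fv φ then x else 0
  have hρ : ∀ x, ρ x ∈ insert 0 (L.fv φ) := by
    intro x
    by_cases hx : x ∈ L.fv φ <;> simp [ρ, hx]
  have hρ' : ∀ x ∈ L.fv φ, ρ x = x := fun x hx => by simp [ρ, hx]
  refine hno ⟨fun c => match c with | false => M | true => N,
    fun c => match c with | false => α ∘ ρ | true => β ∘ ρ, ⟨?_, ?_, ?_⟩, ?_, ?_⟩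
  · rintro x (_ | _) (_ | _)
    exacts [rfl, h.rank _ (hρ x), (h.rank _ (hρ x)).symm, rfl]
  · rintro x y (_ | _) (_ | _)
    exacts [rfl, h.pair _ (hρ x) _ (hρ y), (h.pair _ (hρ x) _ (hρ y)).symm, rfl]
  · rintro x y (_ | _) (_ | _)
    exacts [id, (h.eq_iff _ (hρ x) _ (hρ y)).1, (h.eq_iff _ (hρ x) _ (hρ y)).2, id]
  · exact (L.sat_congr φ M _ _ fun x hx => by simp [hρ' x hx]).1 hM
  · exact fun h' => hN ((L.sat_congr φ N _ _ fun x hx => by simp [hρ' x hx]).1 h')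

end BinGuarded

theorem mainTheorem12 (L : BinGuarded.AbstractLogic.{u, v})
    (hL : L.Extends BinGuarded.GFbin.{u}) :
    (L.Compactness ∧ L.InvariantForGFbinBisimulation) ↔ BinGuarded.GFbin.{u}.Extends L := by
  constructor
  · rintro ⟨hc, hi⟩
    choose f h₁ _ h₃ using L.isDefinable_sat hL hc hi
    exact ⟨fun φ => ⟨f φ, h₁ φ⟩, fun φ M α => (h₃ φ M α).symm⟩
  · exact fun h => ⟨L.compactness_of_extends h, L.invariant_of_extends h⟩
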